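/- A \emph{BPA system} consists of finite sets $\mathcal V$ of variables, $\mathcal A$ of actions (possibly including the internal action $\tau$) and $\mathcal R$ of rules $X\xrightarrow{\lambda}\alpha$ with $X\in\mathcal V$, $\lambda\in\mathcal A$, $\alpha\in\mathcal V^*$. Processes are words in $\mathcal V^*$; a rule $X\xrightarrow{\lambda}\alpha$ induces the transitions $X\beta\xrightarrow{\lambda}\alpha\beta$ for all $\beta\in\mathcal V^*$. The system is \emph{normed} if every variable can reach the empty process by a finite sequence of transitions. Write $\Rightarrow$ for the reflexive transitive closure of $\xrightarrow{\tau}$. A symmetric relation $R$ on processes is a \emph{branching bisimulation} if, whenever $\alpha R\beta$ and $\alpha\xrightarrow{\lambda}\alpha'$, either $\lambda=\tau$ and $\alpha' R\beta$, or $\beta\Rightarrow\beta''\xrightarrow{\lambda}\beta'$ for some $\beta'',\beta'$ with $\alpha R\beta''$ and $\alpha' R\beta'$. It is a \emph{weak bisimulation} if the same holds with the second alternative replaced by: $\beta\Rightarrow\gamma_1\xrightarrow{\lambda}\gamma_2\Rightarrow\beta'$ for some $\gamma_1,\gamma_2,\beta'$ with $\alpha' R\beta'$. Branching bisimilarity $\simeq$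 and weak bisimilarity $\approx$ are the largest branching and the largest weak bisimulation. A \emph{Hit-or-Run game} $\mathcal G=(S_0,S_1,\to,s_\vdash,s_\dashv,k_\dashv)$ consists of disjoint finite sets $S_0,S_1$ of states with union $S$, an initial state $s_\vdash\in S$, a final state $s_\dashv\notin S$, a final value $k_\dashv\in\mathbb N$, and a finite set $\to\;\subseteq S\times\mathbb N\times(S\cup\{s_\dashv\})$ of rules such that each label $\ell$ of a rule $(s,\ell,t)$ is $0$ or a power $2^k$ $(k\ge 0)$, and each $s\in S$ has at least one rule $(s,\ell,t)$. A play starts in the configuration $(s_\vdash,0)$; in a configuration $(s,k)$ with $s\in S_i$, Player $i$ chooses a rule $(s,\ell,t)$ and the next configuration is $(t,k+\ell)$; the play ends when $s_\dashv$ is reached. Player $0$ wins a play if it reaches $(s_\dashv,k_\dashv)$ or never reaches $s_\dashv$; Player $1$ wins if it reaches $(s_\dashv,k)$ with $k\neq k_\dashv$. \textbf{Proposition.} There is a function, computable in polynomial time (all numbers being encoded in binary), which maps each Hit-or-Run game $\mathcal G$ to a normed BPA system together with two processes $\gamma,\gamma'$ of it such that \[ \text{Player } 0 \text{ has a winning strategy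 in } \mathcal G \iff \gamma\simeq\gamma' \iff \gamma\approx\gamma' . \] -/

import Mathlib

open Turing Computability

/-! ### BPA systems, branching and weak bisimilarity -/

namespace BPA

/-- Actions: the internal action `tau` and the visible actions, which are named by numbers. -/
inductive Action
  | tau
  | vis (a : ℕ)
  deriving DecidableEq

/-- A rule `lhs --act--> rhs`; variables are named by numbers, processes are words. -/
structure Rule where
  lhs : ℕ
  act : Action
  rhs : List ℕ
  deriving DecidableEq

/-- A BPA system; its finite sets of variables, actions and rules are given by lists. -/
structure System where
  vars : List ℕ
  acts : List Action
  rules : List Rule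
  lhs_mem : ∀ r ∈ rules, r.lhs ∈ vars
  act_mem : ∀ r ∈ rules, r.act ∈ acts
  rhs_mem : ∀ r ∈ rules, ∀ X ∈ r.rhs, X ∈ vars

namespace System

/-- A process is a word over the variables of the system. -/
def IsProc (D : System) (p : List ℕ) : Prop := ∀ X ∈ p, X ∈ D.vars

/-- The labelled transitions `p --l--> q` of processes: the first variable is rewritten. -/
inductive Step (D : System) : List ℕ → Action → List ℕ → Prop
  | head {r : Rule} (hr : r ∈ D.rules) (q : List ℕ) : Step D (r.lhs :: q) r.act (r.rhs ++ q)

/-- `p ⟹ q`: finitely many (possibly zero) internal transitions. -/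
def TauSteps (D : System) : List ℕ → List ℕ → Prop :=
  Relation.ReflTransGen fun p q => D.Step p Action.tau q

/-- A process is normed if it can reach the empty process. -/
def IsNormed (D : System) (p : List ℕ) : Prop :=
  Relation.ReflTransGen (fun p q => ∃ l, D.Step p l q) p []

/-- A system is normed if each of its variables is. -/
def Normed (D : System) : Prop := ∀ X ∈ D.vars, D.IsNormed [X]

structure IsBranchingBisimulation (D : System) (R : List ℕ → List ℕ → Prop) : Prop where
  isProc : ∀ p q, R p q → D.IsProc p ∧ D.IsProc q
  symm : ∀ p q, R p q → R q p
  transfer : ∀ p q l p', R p q → D.Step p l p' →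
    (l = Action.tau ∧ R p' q) ∨
    ∃ q₁ q', D.TauSteps q q₁ ∧ D.Step q₁ l q' ∧ R p q₁ ∧ R p' q'

structure IsWeakBisimulation (D : System) (R : List ℕ → List ℕ → Prop) : Prop where
  isProc : ∀ p q, R p q → D.IsProc p ∧ D.IsProc q
  symm : ∀ p q, R p q → R q p
  transfer : ∀ p q l p', R p q → D.Step p l p' →
    (l = Action.tau ∧ R p' q) ∨
    ∃ q₁ q₂ q', D.TauSteps q q₁ ∧ D.Step q₁ l q₂ ∧ D.TauSteps q₂ q' ∧ R p' q'

/-- Branching bisimilarity: the union of all branching bisimulations. -/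
def BranchingBisimilar (D : System) (p q : List ℕ) : Prop :=
  ∃ R, D.IsBranchingBisimulation R ∧ R p q

/-- Weak bisimilarity: the union of all weak bisimulations. -/
def WeaklyBisimilar (D : System) (p q : List ℕ) : Prop :=
  ∃ R, D.IsWeakBisimulation R ∧ R p q

end System

/-- An instance of the equivalence checking problem: a BPA system with two processes. -/
structure Instance where
  sys : System
  left : List ℕ
  right : List ℕ
  left_mem : sys.IsProc left
  right_mem : sys.IsProc right

end BPA

/-! ### Hit-or-Run games -/

/-- A Hit-or-Run game; states are named by numbers, and the finite sets `S₀`, `S₁` and the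
transition relation are given by lists. An entry `(s, l, t)` is the rule `s --l--> t`. -/
structure HitOrRunGame where
  S₀ : List ℕ
  S₁ : List ℕ
  trans : List (ℕ × ℕ × ℕ)
  start : ℕ
  final : ℕ
  finalValue : ℕ
  disjoint : ∀ s ∈ S₀, s ∉ S₁
  start_mem : start ∈ S₀ ∨ start ∈ S₁
  final_not_mem₀ : final ∉ S₀
  final_not_mem₁ : final ∉ S₁
  source_mem : ∀ s l t, (s, l, t) ∈ trans → s ∈ S₀ ∨ s ∈ S₁
  target_mem : ∀ s l t, (s, l, t) ∈ trans → t ∈ S₀ ∨ t ∈ S₁ ∨ t = final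
  label : ∀ s l t, (s, l, t) ∈ trans → l = 0 ∨ ∃ k, l = 2 ^ k
  total : ∀ s, s ∈ S₀ ∨ s ∈ S₁ → ∃ l t, (s, l, t) ∈ trans

namespace HitOrRunGame

/-- One move between configurations (state, counter value). -/
def Move (G : HitOrRunGame) (c d : ℕ × ℕ) : Prop :=
  ∃ l, (c.1, l, d.1) ∈ G.trans ∧ d.2 = c.2 + l

/-- A play is an infinite sequence of configurations that starts in `(start, 0)` and follows the
moves of the game; once the final state is reached, the game is over and the configuration is
repeated for ever. -/
structure IsPlay (G : HitOrRunGame) (c : ℕ → ℕ × ℕ) : Prop where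
  init : c 0 = (G.start, 0)
  move : ∀ i, (c i).1 ≠ G.final → G.Move (c i) (c (i + 1))
  stay : ∀ i, (c i).1 = G.final → c (i + 1) = c i

/-- Player 0 wins a play that hits `(final, finalValue)` or never reaches the final state. -/
def WinsZero (G : HitOrRunGame) (c : ℕ → ℕ × ℕ) : Prop :=
  (∃ i, c i = (G.final, G.finalValue)) ∨ ∀ i, (c i).1 ≠ G.final

/-- A strategy of Player 0 maps each history (a nonempty list of configurations, the current one
last) whose last state belongs to Player 0 to a configuration that can be reached by one move. -/
def IsStrategyZero (G : HitOrRunGame) (σ : List (ℕ × ℕ) → ℕ × ℕ) : Prop :=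
  ∀ (h : List (ℕ × ℕ)) (c : ℕ × ℕ), c.1 ∈ G.S₀ → G.Move c (σ (h ++ [c]))

/-- In the play `c`, Player 0 moves according to `σ`. -/
def Follows (G : HitOrRunGame) (σ : List (ℕ × ℕ) → ℕ × ℕ) (c : ℕ → ℕ × ℕ) : Prop :=
  ∀ i, (c i).1 ∈ G.S₀ → c (i + 1) = σ ((List.range (i + 1)).map c)

/-- Player 0 has a winning strategy. -/
def PlayerZeroWins (G : HitOrRunGame) : Prop :=
  ∃ σ, G.IsStrategyZero σ ∧ ∀ c, G.IsPlay c → G.Follows σ c → G.WinsZero c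

end HitOrRunGame

/-! ### Encodings as words over a finite alphabet -/

namespace Enc

/-- Numbers are written in binary, followed by a comma. -/
def nat (n : ℕ) : List Γ' := (encodeNat n).map Γ'.bit ++ [Γ'.comma]

/-- Lists are the concatenation of their entries in brackets. -/
def list {α : Type} (e : α → List Γ') (l : List α) : List Γ' :=
  Γ'.bra :: l.flatMap e ++ [Γ'.ket]

def trans (r : ℕ × ℕ × ℕ) : List Γ' := nat r.1 ++ nat r.2.1 ++ nat r.2.2

def game (G : HitOrRunGame) : List Γ' :=
  list nat G.S₀ ++ list nat G.S₁ ++ list trans G.trans ++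
    nat G.start ++ nat G.final ++ nat G.finalValue

def action : BPA.Action → List Γ'
  | BPA.Action.tau => [Γ'.blank]
  | BPA.Action.vis a => nat a

def rule (r : BPA.Rule) : List Γ' := nat r.lhs ++ action r.act ++ list nat r.rhs

def bpa (I : BPA.Instance) : List Γ' :=
  list nat I.sys.vars ++ list action I.sys.acts ++ list rule I.sys.rules ++
    list nat I.left ++ list nat I.right

/-- `e` is uniquely readable: no code is a prefix of another one, and no code starts with a
closing bracket. -/
def Readable {α : Type} (e : α → List Γ') : Prop :=
  (∀ x y u v, e x ++ u = e y ++ v → x = y ∧ u = v) ∧ ∀ x u v, e x ++ u ≠ Γ'.ket :: v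

theorem readable_nat : Readable nat := by
  have key : ∀ (a b : List Bool) (u v : List Γ'),
      a.map Γ'.bit ++ Γ'.comma :: u = b.map Γ'.bit ++ Γ'.comma :: v → a = b ∧ u = v := by
    intro a
    induction a with
    | nil => intro b u v h; cases b <;> simp_all
    | cons x a ih =>
      intro b u v h
      cases b with
      | nil => simp at h
      | cons y b =>
        simp only [List.map_cons, List.cons_append, List.cons.injEq, Γ'.bit.injEq] at h
        obtain ⟨h1, h2⟩ := ih b u v h.2
        exact ⟨by rw [h.1, h1], h2⟩
  refine ⟨fun x y u v h => ?_, fun x u v h => ?_⟩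
  · simp only [nat, List.append_assoc, List.singleton_append] at h
    obtain ⟨h1, h2⟩ := key _ _ _ _ h
    refine ⟨?_, h2⟩
    have := congrArg decodeNat h1
    simpa using this
  · simp only [nat, List.append_assoc, List.singleton_append] at h
    cases hx : encodeNat x <;> simp [hx] at h

theorem readable_list {α : Type} {e : α → List Γ'} (he : Readable e) : Readable (list e) := by
  refine ⟨fun x => ?_, fun x u v h => by simp [list] at h⟩
  induction x with
  | nil =>
    intro y u v h
    cases y with
    | nil => simpa [list] using h
    | cons b y =>
      simp only [list, List.flatMap_nil, List.flatMap_cons, List.cons_append, List.nil_append,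
        List.append_assoc, List.cons.injEq, true_and] at h
      exact absurd h.symm (he.2 _ _ _)
  | cons a x ih =>
    intro y u v h
    cases y with
    | nil =>
      simp only [list, List.flatMap_nil, List.flatMap_cons, List.cons_append, List.nil_append,
        List.append_assoc, List.cons.injEq, true_and] at h
      exact absurd h (he.2 _ _ _)
    | cons b y =>
      simp only [list, List.flatMap_cons, List.cons_append,
        List.append_assoc, List.cons.injEq, true_and] at h
      obtain ⟨h1, h2⟩ := he.1 _ _ _ _ h
      obtain ⟨h3, h4⟩ := ih y u v (by simpa [list] using h2)
      exact ⟨by rw [h1, h3], h4⟩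

theorem readable_trans : Readable trans := by
  refine ⟨fun x y u v h => ?_, fun x u v h => ?_⟩
  · simp only [trans, List.append_assoc] at h
    obtain ⟨h1, h⟩ := readable_nat.1 _ _ _ _ h
    obtain ⟨h2, h⟩ := readable_nat.1 _ _ _ _ h
    obtain ⟨h3, h⟩ := readable_nat.1 _ _ _ _ h
    exact ⟨Prod.ext h1 (Prod.ext h2 h3), h⟩
  · simp only [trans, List.append_assoc] at h
    exact readable_nat.2 _ _ _ h

theorem readable_action : Readable action := by
  have aux : ∀ n (u v : List Γ'), nat n ++ u ≠ Γ'.blank :: v := by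
    intro n u v h
    simp only [nat, List.append_assoc, List.singleton_append] at h
    cases hx : encodeNat n <;> simp [hx] at h
  refine ⟨fun x y u v h => ?_, fun x u v h => ?_⟩
  · cases x <;> cases y
    · simpa [action] using h
    · exact absurd h.symm (aux _ _ _)
    · exact absurd h (aux _ _ _)
    · obtain ⟨h1, h⟩ := readable_nat.1 _ _ _ _ h
      exact ⟨by rw [h1], h⟩
  · cases x
    · simp [action] at h
    · exact readable_nat.2 _ _ _ h

theorem readable_rule : Readable rule := by
  refine ⟨fun x y u v h => ?_, fun x u v h => ?_⟩
  · simp only [rule, List.append_assoc] at h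
    obtain ⟨h1, h⟩ := readable_nat.1 _ _ _ _ h
    obtain ⟨h2, h⟩ := readable_action.1 _ _ _ _ h
    obtain ⟨h3, h⟩ := (readable_list readable_nat).1 _ _ _ _ h
    cases x; cases y
    simp_all
  · simp only [rule, List.append_assoc] at h
    exact readable_nat.2 _ _ _ h

/-- The code of a game determines the game. -/
theorem game_injective : Function.Injective game := by
  intro x y h
  simp only [game, List.append_assoc] at h
  obtain ⟨h1, h⟩ := (readable_list readable_nat).1 _ _ _ _ h
  obtain ⟨h2, h⟩ := (readable_list readable_nat).1 _ _ _ _ h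
  obtain ⟨h3, h⟩ := (readable_list readable_trans).1 _ _ _ _ h
  obtain ⟨h4, h⟩ := readable_nat.1 _ _ _ _ h
  obtain ⟨h5, h⟩ := readable_nat.1 _ _ _ _ h
  obtain ⟨h6, h⟩ := readable_nat.1 _ _ [] [] (by simpa using h)
  cases x; cases y
  simp_all

/-- The code of an instance determines the instance. -/
theorem bpa_injective : Function.Injective bpa := by
  intro x y h
  simp only [bpa, List.append_assoc] at h
  obtain ⟨h1, h⟩ := (readable_list readable_nat).1 _ _ _ _ h
  obtain ⟨h2, h⟩ := (readable_list readable_action).1 _ _ _ _ h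
  obtain ⟨h3, h⟩ := (readable_list readable_rule).1 _ _ _ _ h
  obtain ⟨h4, h⟩ := (readable_list readable_nat).1 _ _ _ _ h
  obtain ⟨h5, h⟩ := (readable_list readable_nat).1 _ _ [] [] (by simpa using h)
  obtain ⟨⟨_, _, _, _, _, _⟩, _, _, _, _⟩ := x
  obtain ⟨⟨_, _, _, _, _, _⟩, _, _, _, _⟩ := y
  simp_all

end Enc

/-! ### The symbols and rules of the reduction -/

/-! A counter value v is represented by a stack: a word of symbols `weight l`, with l = 0 or a power
of two, above `bot`, whose weights add up to v. Above stacks stand tests, each of which can be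
erased by an internal move. The system is built so that putting a test on a stack yields an
equivalent process exactly when the test is true of the value of that stack. The instance compares
`win start` on `bot` with `bot` alone.

A test is checked by a challenge: it vanishes with a visible action that the opposite process, which
shows only a stack, must match by a rule of its top symbol. That answer puts new tests into the
stack, and these take over the proof obligation. For `win s` with s in S₀ the answer selects the
game rule, through `any s`; for s in S₁ the challenge selects it, through `every s`; both then push
the label as a weight and continue with `win t`. At the final state the answer asserts every bit of
the value and the absence of overflow. A bit of v + 2^k is determined by bits of v, so a counter
test on a stack reduces to counter tests on the stack below its top symbol. There is no need for
exponentially many symbols: only the exponents, which are bounded by the input length, are ever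
enumerated.

Correctness goes through sets of configurations that are safe for Player 0 (`Closed`), which exist
around the initial configuration exactly when Player 0 wins (`playerZeroWins_of_closed`,
`closed_of_playerZeroWins`). From a closed set, words that differ by true tests below a common part
form a branching bisimulation (`Agree.transfer`). Branching bisimilarity implies weak bisimilarity.
Conversely, for any weak bisimulation the configurations whose `win` test is redundant form a closed
set (`SymWeak.closed`); stack symbols and `guard` make no internal moves, which takes away the
additional freedom of weak replies. The three implications close a cycle, so both equivalences
follow.

For polynomial time, `Emits` is a small calculus of word functions that are computed by multi-stack
programs with a polynomial bound. It is closed under concatenation, local definitions and loops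
(`Emits.append`, `Emits.bind`, `Emits.scan`), and `Emits.computable` turns its programs into
machines. The code of the instance is then assembled from these operations in `emits_toInstance`. -/

namespace HitOrRunGame

/-- The symbols of the reduction. Tests are erasable by an internal move; a test is supposed to be
redundant exactly when it holds for the stack below it. -/
inductive Sym
  /-- bit `j` of the value of the stack is `b` -/
  | bit (j : ℕ) (b : Bool)
  /-- the value of the stack does not overflow -/
  | bounded
  /-- Player 0 wins from the state `s` -/
  | win (s : ℕ)
  /-- Player 0 can win by choosing a rule from `s` -/
  | any (s : ℕ)
  /-- every rule from `s` is won by Player 0 -/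
  | every (s : ℕ)
  /-- Player 0 wins after adding `l` and moving to `t` -/
  | move (l t : ℕ)
  /-- the stack symbol of value `l` -/
  | weight (l : ℕ)
  /-- the bottom of the stack -/
  | bot
  /-- a symbol that separates tests from the moves before them -/
  | guard

/-- A rule over the symbols; a visible action is named by a symbol, and `none` is internal. -/
structure SymRule where
  lhs : Sym
  act : Option Sym
  rhs : List Sym

open HitOrRunGame.Sym

variable (G : HitOrRunGame)

/-- The number of bits that are kept track of. -/
def width : ℕ := (encodeNat G.finalValue).length + (Enc.game G).length

/-- The tests that hold together exactly when the stack has the final value. -/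
def finalTests : List Sym :=
  bounded :: (List.range G.width).map fun p => bit p (G.finalValue.testBit p)

/-- The symbols that may occur on the stack. -/
def stackSyms : List Sym :=
  bot :: weight 0 :: (List.range G.width).map fun k => weight (2 ^ k)

def eraseRule (v : Sym) : SymRule := ⟨v, none, []⟩

def challengeRule (v : Sym) (u : List Sym) : SymRule := ⟨v, some v, u⟩

def answerRule (Y c : Sym) (u : List Sym) : SymRule := ⟨Y, some c, u⟩

/-- The action `bot` names no test and is reserved for popping. All poppable symbols share it, so
popping reveals nothing about the symbol. -/
def popRule (Y : Sym) : SymRule := ⟨Y, some bot, []⟩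

def bitRules (j : ℕ) (b : Bool) : List SymRule :=
  [eraseRule (bit j b), challengeRule (bit j b) [],
    answerRule (weight 0) (bit j b) [weight 0, bit j b]]

/-- The answers of `weight (2 ^ k)` to the challenge of bit `k + m`. -/
def carryRules (k m : ℕ) (b : Bool) : List SymRule :=
  (List.range m).map (fun i => answerRule (weight (2 ^ k)) (bit (k + m) b)
    [weight (2 ^ k), bit (k + m) b, bit (k + i) false]) ++
  [answerRule (weight (2 ^ k)) (bit (k + m) b)
    (weight (2 ^ k) :: bit (k + m) (!b) :: (List.range m).map fun i => bit (k + i) true)]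

def lowRules (k j : ℕ) (b : Bool) : List SymRule :=
  [answerRule (weight (2 ^ k)) (bit j b) [weight (2 ^ k), bit j b]]

def overflowRules (k m : ℕ) : List SymRule :=
  (List.range m).map fun i => answerRule (weight (2 ^ k)) bounded
    [weight (2 ^ k), bounded, bit (k + i) false]

/-- The rules are indexed by an exponent and a distance because a loop supplies, besides its index,
the number of rounds that remain. This is also the reason for the range `n + 1` in the last line:
the round `k = n` contributes no rule, but with it the number of remaining rounds is exactly `n -
k`. -/
def counterRules (n : ℕ) : List SymRule :=
  [popRule guard, eraseRule bounded, challengeRule bounded [],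
    answerRule bot bounded [bot], answerRule (weight 0) bounded [weight 0, bounded]] ++
  (List.range n).flatMap (fun j =>
    answerRule bot (bit j false) [bot] :: (bitRules j false ++ bitRules j true) ++
    (List.range j).flatMap (fun i => lowRules j i false ++ lowRules j i true) ++
    (List.range (j + 1)).flatMap (fun k => carryRules k (j - k) false ++ carryRules k (j - k) true)) ++
  (List.range (n + 1)).flatMap (fun k => overflowRules k (n - k))

/-- After challenge and answer both sides carry a guard, so neither can erase a test before the
guard is popped. What remains is the stack against the same stack with `u` on top. -/
def stateRules (s : ℕ) (u : List Sym) : List SymRule :=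
  [eraseRule (win s), challengeRule (win s) [guard]] ++
  G.stackSyms.map fun Y => answerRule Y (win s) (guard :: u ++ [Y])

/-- The two kinds of states differ in who names the game rule. `every` has one challenge for each
rule, under the name of the corresponding `move`; `any` has a single challenge, and the answering
stack symbol chooses the `move` it inserts. -/
def transRules (r : ℕ × ℕ × ℕ) : List SymRule :=
  [eraseRule (every r.1), answerRule (every r.1) (move r.2.1 r.2.2) [guard, weight r.2.1],
    eraseRule (move r.2.1 r.2.2), challengeRule (move r.2.1 r.2.2) [guard, weight r.2.1]] ++
  G.stackSyms.flatMap fun Y =>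
    [answerRule Y (any r.1) [guard, move r.2.1 r.2.2, Y],
      answerRule Y (move r.2.1 r.2.2) [guard, win r.2.2, weight r.2.1, Y]]

def symRules : List SymRule :=
  G.stackSyms.map popRule ++ counterRules G.width ++
  G.S₀.flatMap (fun s =>
    [eraseRule (any s), challengeRule (any s) [guard]] ++ G.stateRules s [any s]) ++
  G.S₁.flatMap (fun s => G.stateRules s [every s]) ++
  G.stateRules G.final G.finalTests ++
  G.trans.flatMap G.transRules

def HasRule (v : Sym) (a : Option Sym) (u : List Sym) : Prop := ⟨v, a, u⟩ ∈ G.symRules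

/-- The rules, by cases. -/
inductive RuleCases : Sym → Option Sym → List Sym → Prop
  | pop {Y} : Y ∈ G.stackSyms → RuleCases Y (some bot) []
  | popGuard : RuleCases guard (some bot) []
  | eraseBit {j b} : j < G.width → RuleCases (bit j b) none []
  | challengeBit {j b} : j < G.width → RuleCases (bit j b) (some (bit j b)) []
  | eraseBounded : RuleCases bounded none []
  | challengeBounded : RuleCases bounded (some bounded) []
  | botBit {j} : j < G.width → RuleCases bot (some (bit j false)) [bot]
  | botBounded : RuleCases bot (some bounded) [bot]
  | zeroBit {l j b} : j < G.width → l = 0 →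
      RuleCases (weight l) (some (bit j b)) [weight l, bit j b]
  | zeroBounded {l} : l = 0 → RuleCases (weight l) (some bounded) [weight l, bounded]
  | low {l k j b} : k < G.width → j < k → l = 2 ^ k →
      RuleCases (weight l) (some (bit j b)) [weight l, bit j b]
  | keep {l k i j b} : j < G.width → k ≤ i → i < j → l = 2 ^ k →
      RuleCases (weight l) (some (bit j b)) [weight l, bit j b, bit i false]
  | flip {l k j b} : j < G.width → k ≤ j → l = 2 ^ k →
      RuleCases (weight l) (some (bit j b))
        (weight l :: bit j (!b) :: (List.range (j - k)).map fun i => bit (k + i) true)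
  | overflow {l k i} : k ≤ i → i < G.width → l = 2 ^ k →
      RuleCases (weight l) (some bounded) [weight l, bounded, bit i false]
  | eraseWin {s} : s ∈ G.S₀ ∨ s ∈ G.S₁ ∨ s = G.final → RuleCases (win s) none []
  | challengeWin {s} : s ∈ G.S₀ ∨ s ∈ G.S₁ ∨ s = G.final →
      RuleCases (win s) (some (win s)) [guard]
  | answerSome {s Y} : s ∈ G.S₀ → Y ∈ G.stackSyms →
      RuleCases Y (some (win s)) [guard, any s, Y]
  | answerEvery {s Y} : s ∈ G.S₁ → Y ∈ G.stackSyms →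
      RuleCases Y (some (win s)) [guard, every s, Y]
  | answerFinal {Y} : Y ∈ G.stackSyms →
      RuleCases Y (some (win G.final)) (guard :: (G.finalTests ++ [Y]))
  | eraseSome {s} : s ∈ G.S₀ → RuleCases (any s) none []
  | challengeSome {s} : s ∈ G.S₀ → RuleCases (any s) (some (any s)) [guard]
  | eraseEvery {s l t} : (s, l, t) ∈ G.trans → RuleCases (every s) none []
  | challengeEvery {s l t} : (s, l, t) ∈ G.trans →
      RuleCases (every s) (some (move l t)) [guard, weight l]
  | eraseMove {s l t} : (s, l, t) ∈ G.trans → RuleCases (move l t) none []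
  | challengeMove {s l t} : (s, l, t) ∈ G.trans →
      RuleCases (move l t) (some (move l t)) [guard, weight l]
  | answerChoice {s l t Y} : (s, l, t) ∈ G.trans → Y ∈ G.stackSyms →
      RuleCases Y (some (any s)) [guard, move l t, Y]
  | answerMove {s l t Y} : (s, l, t) ∈ G.trans → Y ∈ G.stackSyms →
      RuleCases Y (some (move l t)) [guard, win t, weight l, Y]

variable {G}

theorem HasRule.cases {v a u} (h : G.HasRule v a u) : G.RuleCases v a u := by
  simp only [HasRule, symRules, List.mem_append, List.mem_flatMap, List.mem_map] at h
  rcases h with ((((⟨Y, hY, h⟩ | h) | ⟨s, hs, h⟩) | ⟨s, hs, h⟩) | h) | ⟨⟨s, l, t⟩, hr, h⟩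
  · cases h
    exact .pop hY
  · simp only [counterRules, List.mem_append, List.mem_flatMap, List.mem_cons, List.mem_range,
      List.not_mem_nil, or_false] at h
    rcases h with ((h | h | h | h | h) | ⟨j, hj, (((h | h | h) | ⟨i, hi, h⟩) | ⟨k, hk, h⟩)⟩) |
      ⟨k, hk, h⟩
    · cases h; exact .popGuard
    · cases h; exact .eraseBounded
    · cases h; exact .challengeBounded
    · cases h; exact .botBounded
    · cases h; exact .zeroBounded rfl
    · cases h; exact .botBit hj
    · simp only [bitRules, List.mem_cons, List.not_mem_nil, or_false] at h
      rcases h with h | h | h <;> cases h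
      exacts [.eraseBit hj, .challengeBit hj, .zeroBit hj rfl]
    · simp only [bitRules, List.mem_cons, List.not_mem_nil, or_false] at h
      rcases h with h | h | h <;> cases h
      exacts [.eraseBit hj, .challengeBit hj, .zeroBit hj rfl]
    · simp only [lowRules, List.mem_cons, List.not_mem_nil, or_false] at h
      rcases h with h | h <;> cases h <;> exact .low hj hi rfl
    · simp only [carryRules, List.mem_append, List.mem_map, List.mem_range, List.mem_cons,
        List.not_mem_nil, or_false, Nat.add_sub_of_le (Nat.le_of_lt_succ hk)] at h
      rcases h with (⟨i, hi, h⟩ | h) | (⟨i, hi, h⟩ | h) <;> cases h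
      exacts [.keep hj (by omega) (by omega) rfl, .flip hj (by omega) rfl,
        .keep hj (by omega) (by omega) rfl, .flip hj (by omega) rfl]
    · simp only [overflowRules, List.mem_map, List.mem_range] at h
      obtain ⟨i, hi, h⟩ := h
      cases h
      exact .overflow (by omega) (by omega) rfl
  · simp only [stateRules, List.mem_cons, List.not_mem_nil, or_false, List.mem_append,
      List.mem_map] at h
    rcases h with (h | h) | (h | h) | ⟨Y, hY, h⟩ <;> cases h
    exacts [.eraseSome hs, .challengeSome hs, .eraseWin (.inl hs), .challengeWin (.inl hs),
      .answerSome hs hY]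
  · simp only [stateRules, List.mem_cons, List.not_mem_nil, or_false, List.mem_append,
      List.mem_map] at h
    rcases h with (h | h) | ⟨Y, hY, h⟩ <;> cases h
    exacts [.eraseWin (.inr (.inl hs)), .challengeWin (.inr (.inl hs)), .answerEvery hs hY]
  · simp only [stateRules, List.mem_cons, List.not_mem_nil, or_false, List.mem_append,
      List.mem_map] at h
    rcases h with (h | h) | ⟨Y, hY, h⟩ <;> cases h
    exacts [.eraseWin (.inr (.inr rfl)), .challengeWin (.inr (.inr rfl)), .answerFinal hY]
  · simp only [transRules, List.mem_cons, List.not_mem_nil, or_false, List.mem_append,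
      List.mem_flatMap] at h
    rcases h with (h | h | h | h) | ⟨Y, hY, h | h⟩ <;> cases h
    exacts [.eraseEvery hr, .challengeEvery hr, .eraseMove hr, .challengeMove hr,
      .answerChoice hr hY, .answerMove hr hY]

theorem RuleCases.hasRule {v a u} (h : G.RuleCases v a u) : G.HasRule v a u := by
  have counter : ∀ {r}, r ∈ counterRules G.width → r ∈ G.symRules := fun h => by
    simp only [symRules, List.mem_append]; tauto
  have bits : ∀ {j b r}, j < G.width → r ∈ bitRules j b → r ∈ counterRules G.width := by
    intro j b r hj h
    refine List.mem_append_left _ (List.mem_append_right _ (List.mem_flatMap.2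
      ⟨j, List.mem_range.2 hj, List.mem_append_left _ (List.mem_append_left _
        (List.mem_cons_of_mem _ (List.mem_append.2 ?_)))⟩))
    cases b
    exacts [.inl h, .inr h]
  have lows : ∀ {i j b r}, i < j → j < G.width → r ∈ lowRules j i b → r ∈ counterRules G.width := by
    intro i j b r hi hj h
    refine List.mem_append_left _ (List.mem_append_right _ (List.mem_flatMap.2
      ⟨j, List.mem_range.2 hj, List.mem_append_left _ (List.mem_append_right _
        (List.mem_flatMap.2 ⟨i, List.mem_range.2 hi, List.mem_append.2 ?_⟩))⟩))
    cases b
    exacts [.inl h, .inr h]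
  have carries : ∀ {k j b r}, k ≤ j → j < G.width → r ∈ carryRules k (j - k) b →
      r ∈ counterRules G.width := by
    intro k j b r hk hj h
    refine List.mem_append_left _ (List.mem_append_right _ (List.mem_flatMap.2
      ⟨j, List.mem_range.2 hj, List.mem_append_right _
        (List.mem_flatMap.2 ⟨k, List.mem_range.2 (by omega), List.mem_append.2 ?_⟩)⟩))
    cases b
    exacts [.inl h, .inr h]
  have states₀ : ∀ {s r}, s ∈ G.S₀ → r ∈ [eraseRule (any s), challengeRule (any s) [guard]] ++
      G.stateRules s [any s] → r ∈ G.symRules := fun hs h => by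
    simp only [symRules, List.mem_append, List.mem_flatMap] at h ⊢
    exact .inl (.inl (.inl (.inr ⟨_, hs, h⟩)))
  have states₁ : ∀ {s r}, s ∈ G.S₁ → r ∈ G.stateRules s [every s] → r ∈ G.symRules :=
    fun hs h => by
    simp only [symRules, List.mem_append, List.mem_flatMap] at h ⊢
    exact .inl (.inl (.inr ⟨_, hs, h⟩))
  have statesF : ∀ {r}, r ∈ G.stateRules G.final G.finalTests → r ∈ G.symRules := fun h => by
    simp only [symRules, List.mem_append] at h ⊢
    tauto
  have transs : ∀ {s l t r}, (s, l, t) ∈ G.trans → r ∈ G.transRules (s, l, t) → r ∈ G.symRules :=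
    fun hs h => by
    simp only [symRules, List.mem_append, List.mem_flatMap] at h ⊢
    exact .inr ⟨_, hs, h⟩
  cases h with
  | pop hY =>
    simp only [HasRule, symRules, List.mem_append, List.mem_map]
    exact .inl (.inl (.inl (.inl (.inl ⟨_, hY, rfl⟩))))
  | popGuard => exact counter (by simp [counterRules, popRule])
  | @eraseBit j b hj => exact counter (bits (b := b) hj (.head _))
  | @challengeBit j b hj => exact counter (bits (b := b) hj (.tail _ (.head _)))
  | eraseBounded => exact counter (by simp [counterRules, eraseRule])
  | challengeBounded => exact counter (by simp [counterRules, challengeRule])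
  | botBit hj =>
    refine counter (List.mem_append_left _ (List.mem_append_right _ (List.mem_flatMap.2
      ⟨_, List.mem_range.2 hj, List.mem_append_left _ (List.mem_append_left _ ?_)⟩)))
    exact List.mem_cons_self
  | botBounded => exact counter (by simp [counterRules, answerRule])
  | @zeroBit l j b hj hl =>
    subst hl
    exact counter (bits (b := b) hj (.tail _ (.tail _ (.head _))))
  | zeroBounded hl => subst hl; exact counter (by simp [counterRules, answerRule])
  | @low l k j b hk hj hl => subst hl; exact counter (lows (b := b) hj hk (.head _))
  | @keep l k i j b hj hk hi hl =>
    subst hl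
    refine counter (carries (b := b) (hk.trans hi.le) hj (List.mem_append_left _ (List.mem_map.2
      ⟨i - k, List.mem_range.2 (by omega), ?_⟩)))
    rw [Nat.add_sub_of_le hk, Nat.add_sub_of_le (hk.trans hi.le)]
    rfl
  | @flip l k j b hj hk hl =>
    subst hl
    refine counter (carries (b := b) hk hj (List.mem_append_right _ (List.mem_singleton.2 ?_)))
    rw [Nat.add_sub_of_le hk]
    rfl
  | @overflow l k i hk hi hl =>
    subst hl
    refine counter (List.mem_append_right _ (List.mem_flatMap.2
      ⟨k, List.mem_range.2 (by omega), List.mem_map.2 ⟨i - k, List.mem_range.2 (by omega), ?_⟩⟩))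
    rw [Nat.add_sub_of_le hk]
    rfl
  | eraseWin hs =>
    rcases hs with hs | hs | rfl
    exacts [states₀ hs (by simp [stateRules, eraseRule]), states₁ hs (by simp [stateRules, eraseRule]),
      statesF (by simp [stateRules, eraseRule])]
  | challengeWin hs =>
    rcases hs with hs | hs | rfl
    exacts [states₀ hs (by simp [stateRules, challengeRule]),
      states₁ hs (by simp [stateRules, challengeRule]),
      statesF (by simp [stateRules, challengeRule])]
  | answerSome hs hY => exact states₀ hs (by simp [stateRules, answerRule, hY])
  | answerEvery hs hY => exact states₁ hs (by simp [stateRules, answerRule, hY])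
  | answerFinal hY => exact statesF (by simp [stateRules, answerRule, hY])
  | eraseSome hs => exact states₀ hs (by simp [eraseRule])
  | challengeSome hs => exact states₀ hs (by simp [challengeRule])
  | eraseEvery hr => exact transs hr (by simp [transRules, eraseRule])
  | challengeEvery hr => exact transs hr (by simp [transRules, answerRule])
  | eraseMove hr => exact transs hr (by simp [transRules, eraseRule])
  | challengeMove hr => exact transs hr (by simp [transRules, challengeRule])
  | answerChoice hr hY => exact transs hr (by simp [transRules, answerRule, hY])
  | answerMove hr hY => exact transs hr (by simp [transRules, answerRule, hY])

end HitOrRunGame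

/-! ### The counter -/

theorem Nat.testBit_add_two_pow_of_lt {x k j : ℕ} (h : j < k) :
    (x + 2 ^ k).testBit j = x.testBit j := by
  rw [Nat.add_comm, Nat.testBit_two_pow_add_gt h]

/-- Halving reduces bit j + 1 to bit j: for even x the increment is lost by halving and no carry
arises, for odd x it becomes the increment of x / 2. -/
theorem Nat.testBit_increment (x j : ℕ) :
    (x + 1).testBit j = (x.testBit j ^^ decide (∀ i < j, x.testBit i = true)) := by
  induction j generalizing x with
  | zero =>
    rw [Nat.testBit_zero, Nat.testBit_zero]
    rcases Nat.mod_two_eq_zero_or_one x with hx | hx <;> simp [hx, Nat.add_mod]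
  | succ j ih =>
    rw [Nat.testBit_add_one, Nat.testBit_add_one x]
    have key : (∀ i < j + 1, x.testBit i = true) ↔
        x.testBit 0 = true ∧ ∀ i < j, (x / 2).testBit i = true := by
      constructor
      · exact fun h => ⟨h 0 (by omega), fun i hi => by
          rw [← Nat.testBit_add_one]; exact h _ (by omega)⟩
      · rintro ⟨h0, h⟩ (_ | i) hi
        · exact h0
        · rw [Nat.testBit_add_one]; exact h _ (by omega)
    rcases Nat.mod_two_eq_zero_or_one x with hx | hx
    · have h1 : (x + 1) / 2 = x / 2 := by omega
      have h2 : x.testBit 0 = false := by simp [Nat.testBit_zero, hx]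
      rw [h1, decide_eq_false (fun h => by simpa [h2] using h 0 (by omega)), Bool.xor_false]
    · have h1 : (x + 1) / 2 = x / 2 + 1 := by omega
      have h2 : x.testBit 0 = true := by simp [Nat.testBit_zero, hx]
      rw [h1, ih]
      congr 2
      simp only [key, h2, true_and]

/-- Dropping the k low bits turns the addition of 2^k into an increment. -/
theorem Nat.testBit_add_two_pow {x k j : ℕ} (h : k ≤ j) :
    (x + 2 ^ k).testBit j =
      (x.testBit j ^^ decide (∀ i, k ≤ i → i < j → x.testBit i = true)) := by
  obtain ⟨m, rfl⟩ := Nat.exists_eq_add_of_le' h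
  rw [Nat.testBit_add, Nat.testBit_add, Nat.add_div_right _ (Nat.two_pow_pos k),
    Nat.testBit_increment]
  congr 2
  refine propext ⟨fun H i hi hj => ?_, fun H i hi => ?_⟩
  · obtain ⟨i, rfl⟩ := Nat.exists_eq_add_of_le' hi
    rw [Nat.testBit_add]
    exact H i (by omega)
  · rw [← Nat.testBit_add]
    exact H _ (by omega) (by omega)

/-- For x < 2^n the sum stays below 2^(n+1), so it overflows exactly when its bit n is set. That bit
is the carry out of the positions k, ..., n - 1, and any zero among them stops it. -/
theorem Nat.add_two_pow_lt_iff {x k n : ℕ} (hk : k < n) :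
    x + 2 ^ k < 2 ^ n ↔ x < 2 ^ n ∧ ∃ i, k ≤ i ∧ i < n ∧ x.testBit i = false := by
  by_cases hx : x < 2 ^ n
  swap
  · exact ⟨fun h => absurd (Nat.lt_of_le_of_lt (Nat.le_add_right _ _) h) hx, fun h => absurd h.1 hx⟩
  have h1 : 2 ^ k < 2 ^ n := Nat.pow_lt_pow_right (by norm_num) hk
  have h2 : x + 2 ^ k < 2 ^ (n + 1) := by rw [pow_succ]; omega
  have h3 := Nat.testBit_add_two_pow (x := x) hk.le
  rw [Nat.testBit_lt_two_pow hx, Bool.false_xor] at h3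
  have h4 : x + 2 ^ k < 2 ^ n ↔ (x + 2 ^ k).testBit n = false := by
    refine ⟨Nat.testBit_lt_two_pow, fun h => ?_⟩
    by_contra hc
    rw [Nat.testBit_of_two_pow_le_and_two_pow_add_one_gt (by omega) h2] at h
    exact absurd h (by decide)
  rw [h4, h3]
  simp only [decide_eq_false_iff_not, not_forall, Bool.not_eq_true, hx, true_and, exists_prop]

/-! ### Stacks, closed sets and the truth of tests -/

namespace HitOrRunGame

open HitOrRunGame.Sym

variable {G : HitOrRunGame}

variable (G) in
/-- A stack of the reduction, with its value. -/
inductive IsStack : List Sym → ℕ → Prop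
  | bot : IsStack [bot] 0
  | push {l w v} : weight l ∈ G.stackSyms → IsStack w v → IsStack (weight l :: w) (v + l)

theorem IsStack.mem {Y w v} (h : G.IsStack (Y :: w) v) : Y ∈ G.stackSyms := by
  cases h with
  | bot => simp [stackSyms]
  | push h _ => exact h

theorem weight_mem_stackSyms {l : ℕ} :
    weight l ∈ G.stackSyms ↔ l = 0 ∨ ∃ k < G.width, l = 2 ^ k := by
  simp [stackSyms, eq_comm]

variable (G) in
/-- A set of configurations in which Player 0 can stay, and which is safe for him. -/
structure Closed (I : ℕ → ℕ → Prop) : Prop where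
  state : ∀ {s v}, I s v → s ∈ G.S₀ ∨ s ∈ G.S₁ ∨ s = G.final
  some : ∀ {s v}, s ∈ G.S₀ → I s v → ∃ l t, (s, l, t) ∈ G.trans ∧ I t (v + l)
  every : ∀ {s v l t}, s ∈ G.S₁ → I s v → (s, l, t) ∈ G.trans → I t (v + l)
  final : ∀ {v}, I G.final v → v = G.finalValue

variable (G) in
/-- The test `t` holds for a stack of value `v`. -/
def Holds (I : ℕ → ℕ → Prop) (t : Sym) (v : ℕ) : Prop :=
  match t with
  | bit j b => j < G.width ∧ v.testBit j = b
  | bounded => v < 2 ^ G.width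
  | win s => I s v
  | any s => s ∈ G.S₀ ∧ I s v
  | every s => s ∈ G.S₁ ∧ I s v
  | move l t => I t (v + l)
  | _ => False

theorem length_encodePosNum (p : PosNum) : (p : ℕ) < 2 ^ (encodePosNum p).length := by
  induction p with
  | one => simp [encodePosNum]
  | bit1 p ih => rw [PosNum.cast_bit1, encodePosNum, List.length_cons, pow_succ]; omega
  | bit0 p ih => rw [PosNum.cast_bit0, encodePosNum, List.length_cons, pow_succ]; omega

theorem lt_two_pow_length_encodeNat (n : ℕ) : n < 2 ^ (encodeNat n).length := by
  conv_lhs => rw [← Num.to_of_nat n]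
  rw [encodeNat]
  cases (n : Num) with
  | zero => simp [encodeNum]
  | pos p => exact length_encodePosNum p

theorem finalValue_lt : G.finalValue < 2 ^ G.width :=
  (lt_two_pow_length_encodeNat _).trans_le (Nat.pow_le_pow_right (by norm_num) (Nat.le_add_right _ _))

/-- The binary code of a label 2^k has more than k digits and is a part of the code of the game.
This is why the length of that code is a summand of `width`. -/
theorem weight_mem_of_trans {s l t} (h : (s, l, t) ∈ G.trans) : weight l ∈ G.stackSyms := by
  rw [weight_mem_stackSyms]
  rcases G.label s l t h with rfl | ⟨k, rfl⟩
  · exact .inl rfl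
  · refine .inr ⟨k, ?_, rfl⟩
    have h1 : (encodeNat (2 ^ k)).length ≤ (Enc.game G).length := by
      have h2 : (encodeNat (2 ^ k)).length ≤ (Enc.trans (s, 2 ^ k, t)).length := by
        simp [Enc.trans, Enc.nat]; omega
      have h3 : (Enc.trans (s, 2 ^ k, t)).length ≤ (G.trans.flatMap Enc.trans).length := by
        rw [List.length_flatMap]
        exact List.single_le_sum (by simp) _ (List.mem_map_of_mem h)
      have h4 : (G.trans.flatMap Enc.trans).length ≤ (Enc.game G).length := by
        simp only [Enc.game, Enc.list, List.length_append, List.length_cons]; omega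
      omega
    have h5 : 2 ^ k < 2 ^ (encodeNat (2 ^ k)).length := lt_two_pow_length_encodeNat _
    have h6 : k < (encodeNat (2 ^ k)).length := (Nat.pow_lt_pow_iff_right (by norm_num)).1 h5
    simp only [width]
    omega

/-- Below the width the bits agree by the bit tests; from there on both numbers have only zero bits,
as both are less than 2 to the width. -/
theorem holds_finalTests {I v} : (∀ t ∈ G.finalTests, G.Holds I t v) ↔ v = G.finalValue := by
  simp only [finalTests, List.mem_cons, List.mem_map, List.mem_range, forall_eq_or_imp, Holds,
    forall_exists_index, and_imp, forall_apply_eq_imp_iff₂]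
  constructor
  · rintro ⟨hv, h⟩
    refine Nat.eq_of_testBit_eq fun i => ?_
    by_cases hi : i < G.width
    · exact (h i hi).2
    · have h1 : 2 ^ G.width ≤ 2 ^ i := Nat.pow_le_pow_right (by norm_num) (by omega)
      rw [Nat.testBit_lt_two_pow (hv.trans_le h1),
        Nat.testBit_lt_two_pow (finalValue_lt.trans_le h1)]
  · rintro rfl
    exact ⟨finalValue_lt, fun p hp => ⟨hp, rfl⟩⟩

end HitOrRunGame

/-! ### Reduction of a counter test to counter tests one level deeper -/

namespace HitOrRunGame

open HitOrRunGame.Sym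

variable {G : HitOrRunGame}

/-- The tests that inspect the value of the stack. -/
def Sym.IsCounterTest : Sym → Prop
  | bit _ _ => True
  | bounded => True
  | _ => False

/-- A true counter test can be answered by the top symbol of the stack. -/
theorem exists_answer {I : ℕ → ℕ → Prop} {Y w v t} (hw : G.IsStack (Y :: w) v)
    (ht : t.IsCounterTest) (h : G.Holds I t v) :
    ∃ C, G.RuleCases Y (some t) (Y :: C) ∧
      (C = [] ∨ ∃ v', G.IsStack w v' ∧ ∀ c ∈ C, G.Holds I c v') := by
  cases t with
  | bit j b =>
    obtain ⟨hj, hb⟩ := h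
    cases hw with
    | bot =>
      rw [Nat.zero_testBit] at hb
      subst hb
      exact ⟨[], .botBit hj, .inl rfl⟩
    | @push l _ v hl hw =>
      rcases weight_mem_stackSyms.1 hl with rfl | ⟨k, hk, rfl⟩
      · exact ⟨_, .zeroBit hj rfl, .inr ⟨_, hw, by simpa [Holds] using ⟨hj, hb⟩⟩⟩
      · rcases lt_or_ge j k with hjk | hjk
        · rw [Nat.testBit_add_two_pow_of_lt hjk] at hb
          exact ⟨_, .low hk hjk rfl, .inr ⟨_, hw, by simpa [Holds] using ⟨hj, hb⟩⟩⟩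
        · rw [Nat.testBit_add_two_pow hjk] at hb
          -- Either the carry reaches position j, and the answer asserts all ones below it and the
          -- opposite bit; or some zero stops the carry, and the answer points at one such zero.
          by_cases hc : ∀ i, k ≤ i → i < j → v.testBit i = true
          · refine ⟨_, .flip hj hjk rfl, .inr ⟨_, hw, ?_⟩⟩
            simp only [List.mem_cons, List.mem_map, List.mem_range, forall_eq_or_imp, Holds,
              forall_exists_index, and_imp, forall_apply_eq_imp_iff₂]
            rw [decide_eq_true hc, Bool.xor_true] at hb
            exact ⟨⟨hj, by rw [← hb, Bool.not_not]⟩,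
              fun i hi => ⟨by omega, hc _ (by omega) (by omega)⟩⟩
          · rw [decide_eq_false hc, Bool.xor_false] at hb
            push Not at hc
            obtain ⟨i, hi, hij, hi'⟩ := hc
            refine ⟨_, .keep hj hi hij rfl, .inr ⟨_, hw, ?_⟩⟩
            simpa [Holds, hj, hb, hi'] using by omega
  | bounded =>
    cases hw with
    | bot => exact ⟨[], .botBounded, .inl rfl⟩
    | @push l _ v hl hw =>
      rcases weight_mem_stackSyms.1 hl with rfl | ⟨k, hk, rfl⟩
      · exact ⟨_, .zeroBounded rfl, .inr ⟨_, hw, by simpa [Holds] using h⟩⟩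
      · obtain ⟨hv, i, hi, hin, hb⟩ := (Nat.add_two_pow_lt_iff hk).1 h
        exact ⟨_, .overflow hi hin rfl, .inr ⟨_, hw, by simp [Holds, hv, hin, hb]⟩⟩
  | _ => exact ht.elim

/-- An answer to a counter test keeps the top symbol of the stack, and is correct if the tests
that it puts below that symbol are true. -/
theorem holds_of_answer {I : ℕ → ℕ → Prop} {Y w v t r} (hw : G.IsStack (Y :: w) v)
    (ht : t.IsCounterTest) (h : G.RuleCases Y (some t) r) :
    ∃ C, r = Y :: C ∧ (∀ c ∈ C, c.IsCounterTest ∧ G.RuleCases c none []) ∧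
      (Y = bot → C = []) ∧
      ((∀ v', G.IsStack w v' → ∀ c ∈ C, G.Holds I c v') → G.Holds I t v) := by
  have erase : ∀ {j b}, j < G.width → (bit j b).IsCounterTest ∧ G.RuleCases (bit j b) none [] :=
    fun hj => ⟨trivial, .eraseBit hj⟩
  cases h with
  | pop => exact ht.elim
  | popGuard => exact ht.elim
  | challengeBit => cases hw
  | challengeBounded => cases hw
  | botBit hj => cases hw; exact ⟨[], rfl, by simp, by simp, fun _ => ⟨hj, Nat.zero_testBit _⟩⟩
  | botBounded => cases hw; exact ⟨[], rfl, by simp, by simp, fun _ => Nat.two_pow_pos _⟩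
  | zeroBit hj hl =>
    subst hl
    cases hw with | push hl hw =>
    exact ⟨_, rfl, by simpa using erase hj, by simp, fun H => H _ hw _ (by simp)⟩
  | zeroBounded hl =>
    subst hl
    cases hw with | push hl hw =>
    exact ⟨_, rfl, by simpa using ⟨trivial, .eraseBounded⟩, by simp, fun H => H _ hw _ (by simp)⟩
  | low hk hj hl =>
    subst hl
    cases hw with | push hl hw =>
    refine ⟨_, rfl, by simpa using erase (hj.trans hk), by simp, fun H => ?_⟩
    exact ⟨hj.trans hk, by
      rw [Nat.testBit_add_two_pow_of_lt hj]; exact (H _ hw _ List.mem_cons_self).2⟩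
  | keep hj hk hi hl =>
    subst hl
    cases hw with | push hl hw =>
    refine ⟨_, rfl, by simpa using ⟨erase hj, erase (hi.trans hj)⟩, by simp, fun H => ⟨hj, ?_⟩⟩
    have h1 := H _ hw _ List.mem_cons_self
    have h2 := H _ hw _ (List.mem_cons_of_mem _ List.mem_cons_self)
    rw [Nat.testBit_add_two_pow (hk.trans hi.le), decide_eq_false, Bool.xor_false, h1.2]
    exact fun h => by simpa [h2.2] using h _ hk hi
  | @flip l k j b hj hk hl =>
    subst hl
    cases hw with | push hl hw =>
    refine ⟨_, rfl, ?_, by simp, fun H => ⟨hj, ?_⟩⟩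
    · simp only [List.mem_cons, List.mem_map, List.mem_range, forall_eq_or_imp,
        forall_exists_index, and_imp, forall_apply_eq_imp_iff₂]
      exact ⟨erase hj, fun i hi => erase (by omega)⟩
    · have h1 := H _ hw _ List.mem_cons_self
      rw [Nat.testBit_add_two_pow hk, decide_eq_true, Bool.xor_true, h1.2, Bool.not_not]
      intro i hi hij
      refine (H _ hw (bit i true) (List.mem_cons_of_mem _ (List.mem_map.2
        ⟨i - k, List.mem_range.2 (by omega), by rw [Nat.add_sub_of_le hi]⟩))).2
  | overflow hk hi hl =>
    subst hl
    cases hw with | push hl hw =>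
    refine ⟨_, rfl, by simpa using ⟨⟨trivial, .eraseBounded⟩, erase hi⟩, by simp, fun H => ?_⟩
    exact (Nat.add_two_pow_lt_iff (hk.trans_lt hi)).2 ⟨H _ hw _ List.mem_cons_self, _, hk, hi,
      (H _ hw _ (List.mem_cons_of_mem _ List.mem_cons_self)).2⟩
  | _ => exact ht.elim

end HitOrRunGame

namespace HitOrRunGame

open HitOrRunGame.Sym

/-! ### The BPA system of a game -/

def actName (ν : Sym → ℕ) : Option Sym → BPA.Action
  | none => BPA.Action.tau
  | some c => BPA.Action.vis (ν c)

def SymRule.toRule (ν : Sym → ℕ) (r : SymRule) : BPA.Rule := ⟨ν r.lhs, actName ν r.act, r.rhs.map ν⟩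

theorem actName_injective {ν : Sym → ℕ} (hν : ν.Injective) : (actName ν).Injective := by
  intro a b h
  cases a <;> cases b <;> simp_all [actName]
  exact hν h

variable (G : HitOrRunGame) (ν : Sym → ℕ)

/-- The BPA system of a game; the symbols are named by `ν`. -/
def toSystem : BPA.System where
  vars := G.symRules.flatMap fun r => (r.lhs :: r.rhs).map ν
  acts := G.symRules.map fun r => actName ν r.act
  rules := G.symRules.map fun r => r.toRule ν
  lhs_mem := by
    simp only [List.mem_map, List.mem_flatMap, forall_exists_index, and_imp]
    rintro _ r hr rfl
    exact ⟨r, hr, r.lhs, by simp, rfl⟩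
  act_mem := by
    simp only [List.mem_map, forall_exists_index, and_imp]
    rintro _ r hr rfl
    exact ⟨r, hr, rfl⟩
  rhs_mem := by
    simp only [List.mem_map, List.mem_flatMap, forall_exists_index, and_imp]
    rintro _ r hr rfl X hX
    obtain ⟨v, hv, rfl⟩ := List.mem_map.1 hX
    exact ⟨r, hr, v, by simp [hv], rfl⟩

/-- Transitions of words over the symbols. -/
inductive SymStep : List Sym → Option Sym → List Sym → Prop
  | head {v a u} (h : G.RuleCases v a u) (p : List Sym) : SymStep (v :: p) a (u ++ p)

def SymTau : List Sym → List Sym → Prop := Relation.ReflTransGen fun p q => G.SymStep p none q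

/-- The symbols that have a rule. -/
def IsSym (v : Sym) : Prop := ∃ a u, G.RuleCases v a u ∧ u = []

variable {G ν}

theorem step_of_symStep {p q : List Sym} {a} (h : G.SymStep p a q) :
    (G.toSystem ν).Step (p.map ν) (actName ν a) (q.map ν) := by
  cases h with
  | @head v a u h p =>
    have := BPA.System.Step.head (D := G.toSystem ν) (r := SymRule.toRule ν ⟨v, a, u⟩)
      (List.mem_map.2 ⟨_, h.hasRule, rfl⟩) (p.map ν)
    simpa [SymRule.toRule] using this

theorem symStep_of_step (hν : ν.Injective) {p : List Sym} {l q}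
    (h : (G.toSystem ν).Step (p.map ν) l q) :
    ∃ a q', l = actName ν a ∧ q = q'.map ν ∧ G.SymStep p a q' := by
  generalize hp : p.map ν = p' at h
  cases h with
  | @head r hr β =>
    obtain ⟨s, hs, rfl⟩ := List.mem_map.1 hr
    cases p with
    | nil => simp at hp
    | cons v p =>
      simp only [List.map_cons, List.cons.injEq] at hp
      obtain ⟨hv, rfl⟩ := hp
      obtain rfl := hν hv
      exact ⟨s.act, s.rhs ++ p, rfl, by simp [SymRule.toRule], .head (HasRule.cases hs) p⟩

theorem tauSteps_of_symTau {p q : List Sym} (h : G.SymTau p q) :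
    (G.toSystem ν).TauSteps (p.map ν) (q.map ν) := by
  induction h with
  | refl => exact .refl
  | tail _ h ih => exact ih.tail (step_of_symStep h)

theorem symTau_of_tauSteps (hν : ν.Injective) {p : List Sym} {q}
    (h : (G.toSystem ν).TauSteps (p.map ν) q) : ∃ q', q = q'.map ν ∧ G.SymTau p q' := by
  induction h with
  | refl => exact ⟨p, rfl, .refl⟩
  | tail _ h ih =>
    obtain ⟨q', rfl, hq⟩ := ih
    obtain ⟨a, q'', ha, rfl, h⟩ := symStep_of_step hν h
    obtain rfl : a = none := actName_injective hν ha.symm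
    exact ⟨q'', rfl, hq.tail h⟩

theorem stackSyms_isSym {Y} (h : Y ∈ G.stackSyms) : G.IsSym Y := ⟨_, _, .pop h, rfl⟩

theorem RuleCases.isSym {v a u} (h : G.RuleCases v a u) : ∀ x ∈ v :: u, G.IsSym x := by
  have bit : ∀ {j b}, j < G.width → G.IsSym (bit j b) := fun hj => ⟨_, _, .eraseBit hj, rfl⟩
  have bounded : G.IsSym bounded := ⟨_, _, .eraseBounded, rfl⟩
  have guard : G.IsSym Sym.guard := ⟨_, _, .popGuard, rfl⟩
  have bot : G.IsSym bot := stackSyms_isSym (by simp [stackSyms])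
  have zero : ∀ {l}, l = 0 → G.IsSym (weight l) := fun h =>
    stackSyms_isSym (weight_mem_stackSyms.2 (.inl h))
  have weight : ∀ {k l}, k < G.width → l = 2 ^ k → G.IsSym (weight l) := fun hk h =>
    stackSyms_isSym (weight_mem_stackSyms.2 (.inr ⟨_, hk, h⟩))
  have win : ∀ {s}, s ∈ G.S₀ ∨ s ∈ G.S₁ ∨ s = G.final → G.IsSym (win s) := fun hs =>
    ⟨_, _, .eraseWin hs, rfl⟩
  have final : ∀ x ∈ G.finalTests, G.IsSym x := by
    simp only [finalTests, List.mem_cons, List.mem_map, List.mem_range, forall_eq_or_imp,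
      forall_exists_index, and_imp, forall_apply_eq_imp_iff₂]
    exact ⟨bounded, fun p hp => bit hp⟩
  have wt : ∀ {s l t}, (s, l, t) ∈ G.trans → G.IsSym (Sym.weight l) := fun h =>
    stackSyms_isSym (weight_mem_of_trans h)
  cases h <;>
    simp only [List.mem_cons, List.mem_append, List.mem_map, List.mem_range, List.not_mem_nil,
      or_false, forall_eq_or_imp, forall_eq, forall_exists_index, and_imp,
      forall_apply_eq_imp_iff₂]
  case pop h => exact stackSyms_isSym h
  case popGuard => exact guard
  case eraseBit h => exact bit h
  case challengeBit h => exact bit h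
  case eraseBounded => exact bounded
  case challengeBounded => exact bounded
  case botBit h => exact ⟨bot, bot⟩
  case botBounded => exact ⟨bot, bot⟩
  case zeroBit hj hl => exact ⟨zero hl, zero hl, bit hj⟩
  case zeroBounded hl => exact ⟨zero hl, zero hl, bounded⟩
  case low hk hj hl => exact ⟨weight hk hl, weight hk hl, bit (hj.trans hk)⟩
  case keep hj hk hi hl =>
    exact ⟨weight (by omega) hl, weight (by omega) hl, bit hj, bit (by omega)⟩
  case flip hj hk hl =>
    exact ⟨weight (by omega) hl, weight (by omega) hl, bit hj, fun i hi => bit (by omega)⟩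
  case overflow hk hi hl =>
    exact ⟨weight (by omega) hl, weight (by omega) hl, bounded, bit hi⟩
  case eraseWin h => exact win h
  case challengeWin h => exact ⟨win h, guard⟩
  case answerSome hs hY =>
    exact ⟨stackSyms_isSym hY, guard, ⟨_, _, .eraseSome hs, rfl⟩, stackSyms_isSym hY⟩
  case answerEvery s hs hY =>
    obtain ⟨l, t, h⟩ := G.total s (.inr hs)
    exact ⟨stackSyms_isSym hY, guard, ⟨_, _, .eraseEvery h, rfl⟩, stackSyms_isSym hY⟩
  case answerFinal hY =>
    refine ⟨stackSyms_isSym hY, guard, ?_⟩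
    rintro x (hx | rfl)
    exacts [final x hx, stackSyms_isSym hY]
  case eraseSome h => exact ⟨_, _, .eraseSome h, rfl⟩
  case challengeSome h => exact ⟨⟨_, _, .eraseSome h, rfl⟩, guard⟩
  case eraseEvery h => exact ⟨_, _, .eraseEvery h, rfl⟩
  case challengeEvery h => exact ⟨⟨_, _, .eraseEvery h, rfl⟩, guard, wt h⟩
  case eraseMove h => exact ⟨_, _, .eraseMove h, rfl⟩
  case challengeMove h => exact ⟨⟨_, _, .eraseMove h, rfl⟩, guard, wt h⟩
  case answerChoice h hY =>
    exact ⟨stackSyms_isSym hY, guard, ⟨_, _, .eraseMove h, rfl⟩, stackSyms_isSym hY⟩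
  case answerMove h hY =>
    exact ⟨stackSyms_isSym hY, guard, win (G.target_mem _ _ _ h), wt h, stackSyms_isSym hY⟩

theorem mem_vars {v} (h : G.IsSym v) : ν v ∈ (G.toSystem ν).vars := by
  obtain ⟨a, u, h, -⟩ := h
  exact List.mem_flatMap.2 ⟨_, h.hasRule, List.mem_map.2 ⟨v, by simp, rfl⟩⟩

theorem exists_of_mem_vars {x} (h : x ∈ (G.toSystem ν).vars) : ∃ v, ν v = x ∧ G.IsSym v := by
  obtain ⟨⟨v, a, u⟩, hr, hx⟩ := List.mem_flatMap.1 h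
  obtain ⟨y, hy, rfl⟩ := List.mem_map.1 hx
  exact ⟨y, rfl, (HasRule.cases hr).isSym y hy⟩

theorem isProc_map {p : List Sym} (h : ∀ v ∈ p, G.IsSym v) : (G.toSystem ν).IsProc (p.map ν) := by
  intro X hX
  obtain ⟨v, hv, rfl⟩ := List.mem_map.1 hX
  exact mem_vars (h v hv)

/-- Every symbol of the system has a rule with empty right-hand side, internal for tests and visible
for stack symbols and the guard; this is what `IsSym` records. -/
theorem normed_toSystem : (G.toSystem ν).Normed := by
  intro x hx
  obtain ⟨v, rfl, a, u, h, rfl⟩ := exists_of_mem_vars hx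
  exact .single ⟨_, step_of_symStep (.head h [])⟩

theorem start_isSym : G.IsSym (win G.start) :=
  ⟨_, _, .eraseWin (G.start_mem.imp_right .inl), rfl⟩

variable (G ν) in
/-- The equivalence problem of a game: is the test whether Player 0 wins redundant on the empty
stack? -/
def toInstance : BPA.Instance where
  sys := G.toSystem ν
  left := [win G.start, bot].map ν
  right := [bot].map ν
  left_mem := isProc_map (by simpa using ⟨start_isSym, stackSyms_isSym (by simp [stackSyms])⟩)
  right_mem := isProc_map (by simpa using stackSyms_isSym (by simp [stackSyms]))

/-! ### Player 0 wins: the test is redundant -/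

variable (G) in
/-- `p` arises from `w` by inserting true tests. -/
inductive Expands (I : ℕ → ℕ → Prop) : List Sym → List Sym → Prop
  | nil : Expands I [] []
  | cons {w p} (Y : Sym) : Expands I w p → Expands I (Y :: w) (Y :: p)
  | test {w p v t} : G.IsStack w v → G.Holds I t v → G.RuleCases t none [] → Expands I w p →
      Expands I w (t :: p)

theorem Expands.append {I w p} (h : G.Expands I w p) (u : List Sym) :
    G.Expands I (u ++ w) (u ++ p) := by
  induction u with
  | nil => exact h
  | cons Y u ih => exact .cons Y ih

theorem Expands.tests {I w p v} {C : List Sym} (h : G.Expands I w p) (hw : G.IsStack w v)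
    (hC : ∀ t ∈ C, G.Holds I t v ∧ G.RuleCases t none []) : G.Expands I w (C ++ p) := by
  induction C with
  | nil => exact h
  | cons t C ih =>
    simp only [List.mem_cons, forall_eq_or_imp] at hC
    exact .test hw hC.1.1 hC.1.2 (ih hC.2)

/-- The inserted tests above the top stack symbol can all be erased silently. This is the only use
of internal moves in a reply of the branching bisimulation. -/
theorem Expands.exists_symTau {I Y w q} (h : G.Expands I (Y :: w) q) :
    ∃ q', G.SymTau q (Y :: q') ∧ G.Expands I w q' := by
  generalize hw : Y :: w = w' at h
  induction h with
  | nil => cases hw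
  | cons Z h => cases hw; exact ⟨_, .refl, h⟩
  | test _ _ ht _ ih =>
    obtain ⟨q', h1, h2⟩ := ih hw
    exact ⟨q', .head (.head ht _) h1, h2⟩

/-- Every challenge of a true test can be answered by the top symbol of the stack. -/
theorem exists_answer_of_holds {I t Y w v c u} (hI : G.Closed I) (hw : G.IsStack (Y :: w) v)
    (ht : G.Holds I t v) (hc : G.RuleCases t (some c) u) :
    ∃ r, G.RuleCases Y (some c) r ∧
      ∀ q, G.Expands I w q → G.Expands I (u ++ Y :: w) (r ++ q) := by
  have hY := hw.mem
  have counter : t.IsCounterTest → u = [] → c = t → ∃ r, G.RuleCases Y (some c) r ∧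
      ∀ q, G.Expands I w q → G.Expands I (u ++ Y :: w) (r ++ q) := by
    rintro h rfl rfl
    obtain ⟨C, hC, hh⟩ := exists_answer hw h ht
    refine ⟨_, hC, fun q hq => .cons Y ?_⟩
    rcases hh with rfl | ⟨v', hv', hh⟩
    · exact hq
    · obtain ⟨C', h1, h2, -, -⟩ := holds_of_answer (I := I) hw h hC
      cases h1
      exact hq.tests hv' fun x hx => ⟨hh x hx, (h2 x hx).2⟩
  have below : ∀ {x r q}, G.Holds I x v → G.RuleCases x none [] → r = [Sym.guard, x, Y] →
      G.Expands I w q → G.Expands I ([Sym.guard] ++ Y :: w) (r ++ q) := by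
    rintro x _ q hx hx' rfl hq
    exact .cons _ (.test hw hx hx' (.cons Y hq))
  have moves : ∀ {s l t}, I t (v + l) → (s, l, t) ∈ G.trans →
      ∃ r, G.RuleCases Y (some (move l t)) r ∧
      ∀ q, G.Expands I w q → G.Expands I ([Sym.guard, weight l] ++ Y :: w) (r ++ q) := by
    intro s l t ht hr
    -- The inserted `win t` stands above the new weight, so it is evaluated on a stack of value `v +
    -- l`, where the closed set contains `(t, v + l)`.
    refine ⟨_, .answerMove hr hY, fun q hq => .cons _ (.test (v := v + l) ?_ ht
      (.eraseWin (G.target_mem _ _ _ hr)) (.cons _ (.cons _ hq)))⟩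
    exact .push (weight_mem_of_trans hr) hw
  have absurd : t ∉ G.stackSyms := fun h => by
    simp only [stackSyms, List.mem_cons, List.mem_map] at h
    rcases h with rfl | rfl | ⟨k, -, rfl⟩ <;> exact ht.elim
  cases hc with
  | challengeBit => exact counter trivial rfl rfl
  | challengeBounded => exact counter trivial rfl rfl
  | @challengeWin s hs =>
    have ht : I s v := ht
    rcases hs with hs | hs | rfl
    · exact ⟨_, .answerSome hs hY, fun q => below (x := any s) ⟨hs, ht⟩ (.eraseSome hs) rfl⟩
    · obtain ⟨l, t, hr⟩ := G.total s (.inr hs)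
      exact ⟨_, .answerEvery hs hY, fun q => below (x := every s) ⟨hs, ht⟩ (.eraseEvery hr) rfl⟩
    · refine ⟨_, .answerFinal hY, fun q hq => .cons _ ?_⟩
      change G.Expands I (Y :: w) ((G.finalTests ++ [Y]) ++ q)
      rw [List.append_assoc]
      refine Expands.tests (.cons Y hq) hw fun x hx => ⟨holds_finalTests.2 (hI.final ht) x hx, ?_⟩
      simp only [finalTests, List.mem_cons, List.mem_map, List.mem_range] at hx
      rcases hx with rfl | ⟨p, hp, rfl⟩
      exacts [.eraseBounded, .eraseBit hp]
  | challengeSome hs =>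
    obtain ⟨l, t, hr, h⟩ := hI.some hs ht.2
    exact ⟨_, .answerChoice hr hY, fun q => below (x := move l t) h (.eraseMove hr) rfl⟩
  | challengeEvery hr => exact moves (hI.every ht.1 ht.2 hr) hr
  | challengeMove hr => exact moves ht hr
  | _ => first | exact (absurd ‹_›).elim | exact ht.elim

/-- Two words that differ, below a common part, only by true tests. -/
def Agree (G : HitOrRunGame) (I : ℕ → ℕ → Prop) (p q : List Sym) : Prop :=
  ∃ u w p' q', p = u ++ p' ∧ q = u ++ q' ∧ G.Expands I w p' ∧ G.Expands I w q'

theorem Agree.symm {I p q} (h : G.Agree I p q) : G.Agree I q p := by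
  obtain ⟨u, w, p', q', hp, hq, h1, h2⟩ := h
  exact ⟨u, w, q', p', hq, hp, h2, h1⟩

theorem Expands.agree {I w p q} (hp : G.Expands I w p) (hq : G.Expands I w q) : G.Agree I p q :=
  ⟨[], w, p, q, rfl, rfl, hp, hq⟩

/-- A nonempty common part is rewritten identically on both sides. If the moving side shows its own
stack symbol, the other side erases its tests until it shows the same symbol and copies the move. If
it shows a true test, erasing that test needs no reply, and a challenge is answered by the stack
symbol that the other side uncovers. Silent erasures of true tests keep the words in agreement,
which gives the intermediate condition of branching bisimulation. -/
theorem Agree.transfer {I p q a p'} (hI : G.Closed I) (h : G.Agree I p q) (hs : G.SymStep p a p') :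
    (a = none ∧ G.Agree I p' q) ∨
      ∃ q₁ q', G.SymTau q q₁ ∧ G.SymStep q₁ a q' ∧ G.Agree I p q₁ ∧ G.Agree I p' q' := by
  obtain ⟨u, w, p₁, q₁, rfl, rfl, hp, hq⟩ := h
  cases u with
  | cons X u =>
    cases hs with
    | @head _ _ r hr _ =>
      exact .inr ⟨_, _, .refl, .head hr _, ⟨X :: u, w, p₁, q₁, rfl, rfl, hp, hq⟩,
        ⟨r ++ u, w, p₁, q₁, by simp, by simp, hp, hq⟩⟩
  | nil =>
    simp only [List.nil_append] at hs ⊢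
    cases hp with
    | nil => cases hs
    | @cons w p Y hp =>
      cases hs with
      | @head _ _ r hr _ =>
        obtain ⟨q', h1, h2⟩ := hq.exists_symTau
        exact .inr ⟨_, _, h1, .head hr _, (hp.cons Y).agree (h2.cons Y),
          ⟨r, w, p, q', rfl, rfl, hp, h2⟩⟩
    | @test _ p v t hw ht he hp =>
      cases hs with
      | @head _ _ r hr _ =>
        cases a with
        | none =>
          refine .inl ⟨rfl, ?_⟩
          have : r = [] := by
            cases hr <;> rfl
          subst this
          exact hp.agree hq
        | some c =>
          obtain ⟨Y, w, rfl⟩ : ∃ Y w', w = Y :: w' := by cases hw <;> exact ⟨_, _, rfl⟩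
          obtain ⟨q', h1, h2⟩ := hq.exists_symTau
          obtain ⟨r', h3, h4⟩ := exists_answer_of_holds hI hw ht hr
          -- Both results expand the word formed by the right-hand side of the challenge on top of
          -- the unchanged stack.
          exact .inr ⟨_, _, h1, .head h3 _, (hp.test hw ht he).agree (h2.cons Y),
            (hp.append r).agree (h4 q' h2)⟩

theorem SymStep.isSym {p a q} (h : G.SymStep p a q) (hp : ∀ v ∈ p, G.IsSym v) :
    ∀ v ∈ q, G.IsSym v := by
  cases h with
  | head hr p =>
    intro v hv
    rcases List.mem_append.1 hv with hv | hv
    · exact hr.isSym v (by simp [hv])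
    · exact hp v (by simp [hv])

theorem SymTau.isSym {p q} (h : G.SymTau p q) (hp : ∀ v ∈ p, G.IsSym v) :
    ∀ v ∈ q, G.IsSym v := by
  induction h with
  | refl => exact hp
  | tail _ h ih => exact h.isSym ih

theorem branchingBisimilar_of_closed {I} (hν : ν.Injective) (hI : G.Closed I)
    (h : I G.start 0) : (G.toInstance ν).sys.BranchingBisimilar (G.toInstance ν).left
      (G.toInstance ν).right := by
  refine ⟨fun p q => ∃ p' q', p = p'.map ν ∧ q = q'.map ν ∧ (∀ v ∈ p', G.IsSym v) ∧
    (∀ v ∈ q', G.IsSym v) ∧ G.Agree I p' q', ⟨?_, ?_, ?_⟩, ?_⟩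
  · rintro _ _ ⟨p, q, rfl, rfl, hp, hq, -⟩
    exact ⟨isProc_map hp, isProc_map hq⟩
  · rintro _ _ ⟨p, q, rfl, rfl, hp, hq, h⟩
    exact ⟨q, p, rfl, rfl, hq, hp, h.symm⟩
  · rintro _ _ l _ ⟨p, q, rfl, rfl, hp, hq, h⟩ hs
    obtain ⟨a, p', rfl, rfl, hs'⟩ := symStep_of_step hν hs
    rcases h.transfer hI hs' with ⟨rfl, h⟩ | ⟨q₁, q', h1, h2, h3, h4⟩
    · exact .inl ⟨rfl, p', q, rfl, rfl, hs'.isSym hp, hq, h⟩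
    · have hq₁ := SymTau.isSym h1 hq
      exact .inr ⟨_, _, tauSteps_of_symTau h1, step_of_symStep h2,
        ⟨p, q₁, rfl, rfl, hp, hq₁, h3⟩, ⟨p', q', rfl, rfl, hs'.isSym hp, h2.isSym hq₁, h4⟩⟩
  · have hb : G.IsSym bot := stackSyms_isSym (by simp [stackSyms])
    refine ⟨_, _, rfl, rfl, by simpa using ⟨start_isSym, hb⟩, by simpa using hb, ?_⟩
    have h0 : G.Expands I [bot] [bot] := .cons _ .nil
    exact (h0.test (t := win G.start) .bot h (.eraseWin (G.start_mem.imp_right .inl))).agree h0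

end HitOrRunGame

theorem BPA.System.BranchingBisimilar.weakly {D : BPA.System} {p q : List ℕ}
    (h : D.BranchingBisimilar p q) : D.WeaklyBisimilar p q := by
  obtain ⟨R, hR, h⟩ := h
  refine ⟨R, ⟨hR.isProc, hR.symm, fun p q l p' h hs => ?_⟩, h⟩
  exact (hR.transfer p q l p' h hs).imp_right fun ⟨q₁, q', h1, h2, _, h4⟩ =>
    ⟨q₁, q', q', h1, h2, .refl, h4⟩

namespace HitOrRunGame

open HitOrRunGame.Sym

variable {G : HitOrRunGame}

/-! ### If the test is redundant, Player 0 wins -/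

variable (G) in
/-- The weak bisimulation game on words over the symbols. -/
structure SymWeak (R : List Sym → List Sym → Prop) : Prop where
  symm : ∀ {p q}, R p q → R q p
  transfer : ∀ {p q a p'}, R p q → G.SymStep p a p' → (a = none ∧ R p' q) ∨
    ∃ q₁ q₂ q', G.SymTau q q₁ ∧ G.SymStep q₁ a q₂ ∧ G.SymTau q₂ q' ∧ R p' q'

variable (G) in
/-- A word without internal moves. -/
def Stuck (p : List Sym) : Prop := ∀ q, ¬G.SymStep p none q

theorem Stuck.eq {p q} (h : G.Stuck p) (hq : G.SymTau p q) : q = p := by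
  rcases Relation.ReflTransGen.cases_head hq with rfl | ⟨c, hc, -⟩
  exacts [rfl, (h c hc).elim]

theorem stuck_stackSyms {Y} (hY : Y ∈ G.stackSyms) (p) : G.Stuck (Y :: p) := by
  simp only [stackSyms, List.mem_cons, List.mem_map] at hY
  intro q h
  cases h with
  | head h => rcases hY with rfl | rfl | ⟨k, -, rfl⟩ <;> cases h

theorem stuck_guard (p) : G.Stuck (Sym.guard :: p) := by
  intro q h
  cases h with | head h => cases h

theorem IsStack.stuck {w v} (h : G.IsStack w v) : G.Stuck w := by
  cases h with
  | bot => exact stuck_stackSyms (by simp [stackSyms]) _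
  | push h _ => exact stuck_stackSyms h _

theorem symTau_of_erasable {C : List Sym} (h : ∀ c ∈ C, G.RuleCases c none []) (p : List Sym) :
    G.SymTau (C ++ p) p := by
  induction C with
  | nil => exact .refl
  | cons c C ih =>
    simp only [List.mem_cons, forall_eq_or_imp] at h
    exact .head (.head h.1 _) (ih h.2)

namespace SymWeak

variable {R : List Sym → List Sym → Prop} (hR : G.SymWeak R)
include hR

/-- A word without internal moves can reply to an internal move only by staying where it is. -/
theorem absorb {p p' q} (h : R p q) (hq : G.Stuck q) (hp : G.SymTau p p') : R p' q := by
  induction hp with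
  | refl => exact h
  | tail _ hs ih =>
    rcases hR.transfer ih hs with ⟨-, h⟩ | ⟨q₁, q₂, q', h1, h2, -, -⟩
    · exact h
    · rw [hq.eq h1] at h2
      exact (hq _ h2).elim

/-- Without internal moves before and after the visible one, a weak reply is a single application of
a rule of the top symbol. -/
theorem answer {p Y q c p'} (h : R p (Y :: q)) (hY : G.Stuck (Y :: q))
    (hs : G.SymStep p (some c) p') :
    ∃ r, G.RuleCases Y (some c) r ∧ (G.Stuck (r ++ q) → R p' (r ++ q)) := by
  rcases hR.transfer h hs with ⟨h, -⟩ | ⟨q₁, q₂, q', h1, h2, h3, h4⟩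
  · cases h
  · rw [hY.eq h1] at h2
    cases h2 with
    | head hr => exact ⟨_, hr, fun hr' => by rwa [hr'.eq h3] at h4⟩

/-- The action `bot` occurs only in popping rules, so the reply to a pop has to be a pop. -/
theorem pop {Y p q} (h : R (Y :: p) (Y :: q)) (hp : ∀ p, G.Stuck (Y :: p))
    (hY : G.RuleCases Y (some bot) []) (hq : G.Stuck q) : R p q := by
  obtain ⟨r, hr, h⟩ := hR.answer h (hp _) (.head hY _)
  have : r = [] := by
    cases hr <;> rfl
  subst this
  exact h hq

/-- Induction on the stack. The challenge erases the test, the answer inserts tests `C` below the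
top symbol, and popping that symbol on both sides leaves these tests redundant on the rest of the
stack. The word `p` is allowed to be more than the stack itself because a test of `C` is examined
while the later ones still lie beneath it. -/
theorem holds_of_related {I t p w v} (hw : G.IsStack w v) (ht : t.IsCounterTest)
    (he : G.RuleCases t none []) (hp : G.SymTau p w) (h : R (t :: p) w) : G.Holds I t v := by
  induction w generalizing t p v with
  | nil => cases hw
  | cons Y w ih =>
    have hc : G.RuleCases t (some t) [] := by
      cases he with
      | eraseBit hj => exact .challengeBit hj
      | eraseBounded => exact .challengeBounded
      | _ => exact ht.elim
    obtain ⟨r, hr, h⟩ := hR.answer h hw.stuck (.head hc _)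
    obtain ⟨C, rfl, hC, -, hh⟩ := holds_of_answer (I := I) hw ht hr
    refine hh fun v' hv' c hcC => ?_
    have hY := stuck_stackSyms hw.mem
    have h1 : R (Y :: w) (Y :: (C ++ w)) := hR.absorb (h (hY _)) (hY _) hp
    have h2 : R (C ++ w) w := hR.pop (hR.symm h1) hY (.pop hw.mem) hv'.stuck
    obtain ⟨C₁, C₂, rfl⟩ := List.append_of_mem hcC
    -- The tests before `c` are erased silently, which the stack opposite cannot answer by a move.
    have h3 : R (c :: (C₂ ++ w)) w := hR.absorb h2 hv'.stuck (by
      rw [List.append_assoc]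
      exact symTau_of_erasable (fun x hx => (hC x (by simp [hx])).2) _)
    exact ih hv' (hC c hcC).1 (hC c hcC).2
      (symTau_of_erasable (fun x hx => (hC x (by simp [hx])).2) _) h3

/-- The guards make both results of challenge and answer immobile, so they stay related as they are;
popping the guards then exposes the new obligations. -/
theorem challenge {t c u Y w v} (hw : G.IsStack (Y :: w) v) (h : R (t :: Y :: w) (Y :: w))
    (ht : G.RuleCases t (some c) (Sym.guard :: u)) (hu : G.Stuck (u ++ Y :: w)) :
    ∃ r, G.RuleCases Y (some c) r ∧ ∀ C, r = Sym.guard :: C → R (C ++ w) (u ++ Y :: w) := by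
  obtain ⟨r, hr, h⟩ := hR.answer h hw.stuck (.head ht _)
  refine ⟨r, hr, ?_⟩
  rintro C rfl
  exact hR.pop (hR.symm (h (stuck_guard _))) stuck_guard .popGuard hu

/-- Stated for any `x` with this challenge, because `every` and `move` both have it; the stack
symbol has only one answer. -/
theorem move {l t s Y w v} (hw : G.IsStack (Y :: w) v)
    (hr : (s, l, t) ∈ G.trans) {x} (hx : G.RuleCases x (some (move l t)) [Sym.guard, weight l])
    (h : R (x :: Y :: w) (Y :: w)) :
    R (win t :: weight l :: Y :: w) (weight l :: Y :: w) := by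
  obtain ⟨r, hr', h⟩ := hR.challenge hw h hx (stuck_stackSyms (weight_mem_of_trans hr) _)
  have hY := hw.mem
  cases hr' with
  | answerMove _ _ => exact h _ rfl
  | challengeEvery => simp [stackSyms] at hY
  | challengeMove => simp [stackSyms] at hY

/-- The configurations for which the test whether Player 0 wins is redundant are closed. -/
theorem closed : G.Closed fun s v => (s ∈ G.S₀ ∨ s ∈ G.S₁ ∨ s = G.final) ∧
    ∃ w, G.IsStack w v ∧ R (win s :: w) w := by
  have push : ∀ {s l t w v}, G.IsStack w v → (s, l, t) ∈ G.trans →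
      R (win t :: weight l :: w) (weight l :: w) →
      (t ∈ G.S₀ ∨ t ∈ G.S₁ ∨ t = G.final) ∧ ∃ w, G.IsStack w (v + l) ∧ R (win t :: w) w :=
    fun hw hr h => ⟨G.target_mem _ _ _ hr, _, .push (weight_mem_of_trans hr) hw, h⟩
  constructor
  · exact fun h => h.1
  · rintro s v hs ⟨hs', w, hw, h⟩
    obtain ⟨Y, w, rfl⟩ : ∃ Y w', w = Y :: w' := by cases hw <;> exact ⟨_, _, rfl⟩
    have hY := hw.mem
    obtain ⟨r, hr, h⟩ := hR.challenge hw h (.challengeWin hs') hw.stuck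
    cases hr with
    | challengeWin => simp [stackSyms] at hY
    | answerEvery hs₁ => exact (G.disjoint s hs hs₁).elim
    | answerFinal => exact (G.final_not_mem₀ hs).elim
    | answerSome _ _ =>
      obtain ⟨r, hr, h⟩ := hR.challenge hw (h _ rfl) (.challengeSome hs) hw.stuck
      cases hr with
      | challengeSome => simp [stackSyms] at hY
      | answerChoice htr _ =>
        -- The answer to the challenge of `any s` has determined the rule that Player 0 should
        -- choose.
        exact ⟨_, _, htr, push hw htr (hR.move hw htr (.challengeMove htr) (h _ rfl))⟩
  · rintro s v l t hs ⟨hs', w, hw, h⟩ htr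
    obtain ⟨Y, w, rfl⟩ : ∃ Y w', w = Y :: w' := by cases hw <;> exact ⟨_, _, rfl⟩
    have hY := hw.mem
    obtain ⟨r, hr, h⟩ := hR.challenge hw h (.challengeWin hs') hw.stuck
    cases hr with
    | challengeWin => simp [stackSyms] at hY
    | answerSome hs₀ => exact (G.disjoint s hs₀ hs).elim
    | answerFinal => exact (G.final_not_mem₁ hs).elim
    | answerEvery _ _ => exact push hw htr (hR.move hw htr (.challengeEvery htr) (h _ rfl))
  · rintro v ⟨hs', w, hw, h⟩
    obtain ⟨Y, w, rfl⟩ : ∃ Y w', w = Y :: w' := by cases hw <;> exact ⟨_, _, rfl⟩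
    have hY := hw.mem
    obtain ⟨r, hr, h⟩ := hR.challenge hw h (.challengeWin hs') hw.stuck
    generalize hf : G.final = f at hr
    cases hr with
    | challengeWin => simp [stackSyms] at hY
    | answerSome hs₀ => exact (G.final_not_mem₀ (hf ▸ hs₀)).elim
    | answerEvery hs₁ => exact (G.final_not_mem₁ (hf ▸ hs₁)).elim
    | answerFinal =>
      have h : R (G.finalTests ++ Y :: w) (Y :: w) := by
        have := h _ rfl
        rwa [List.append_assoc] at this
      have he : ∀ t ∈ G.finalTests, t.IsCounterTest ∧ G.RuleCases t none [] := by
        intro t ht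
        simp only [finalTests, List.mem_cons, List.mem_map, List.mem_range] at ht
        rcases ht with rfl | ⟨p, hp, rfl⟩
        exacts [⟨trivial, .eraseBounded⟩, ⟨trivial, .eraseBit hp⟩]
      -- The truth of a counter test does not depend on the set `I`, so any set will do here.
      refine (holds_finalTests (G := G) (I := fun _ _ => True)).1 fun t ht => ?_
      have he' := he t ht
      obtain ⟨C₁, C₂, hC⟩ := List.append_of_mem ht
      rw [hC] at he h
      refine hR.holds_of_related (p := C₂ ++ Y :: w) hw he'.1 he'.2
        (symTau_of_erasable (fun x hx => (he x (by simp [hx])).2) _) (hR.absorb h hw.stuck ?_)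
      rw [List.append_assoc]
      exact symTau_of_erasable (fun x hx => (he x (by simp [hx])).2) _

end SymWeak

theorem closed_of_weaklyBisimilar {ν : Sym → ℕ} (hν : ν.Injective)
    (h : (G.toInstance ν).sys.WeaklyBisimilar (G.toInstance ν).left (G.toInstance ν).right) :
    ∃ I, G.Closed I ∧ I G.start 0 := by
  obtain ⟨R, hR, h⟩ := h
  have hW : G.SymWeak fun p q => R (p.map ν) (q.map ν) := by
    refine ⟨fun h => hR.symm _ _ h, fun {p q a p'} h hs => ?_⟩
    rcases hR.transfer _ _ _ _ h (step_of_symStep hs) with ⟨h1, h2⟩ | ⟨q₁, q₂, q', h1, h2, h3, h4⟩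
    · exact .inl ⟨actName_injective (a₂ := none) hν h1, h2⟩
    · obtain ⟨q₁, rfl, h5⟩ := symTau_of_tauSteps hν h1
      obtain ⟨b, q₂, hb, rfl, h6⟩ := symStep_of_step hν h2
      obtain rfl := actName_injective hν hb
      obtain ⟨q', rfl, h7⟩ := symTau_of_tauSteps hν h3
      exact .inr ⟨q₁, q₂, q', h5, h6, h7, h4⟩
  exact ⟨_, hW.closed, G.start_mem.imp_right .inl, [bot], .bot, h⟩

/-! ### Closed sets and winning strategies -/

/-- Player 0 keeps the play inside the closed set by looking only at the current configuration. Such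
a play either never ends or ends with the right value. -/
theorem playerZeroWins_of_closed {I} (hI : G.Closed I) (h : I G.start 0) : G.PlayerZeroWins := by
  classical
  have hmove : ∀ c : ℕ × ℕ, c.1 ∈ G.S₀ → ∃ d, G.Move c d ∧ (I c.1 c.2 → I d.1 d.2) := by
    rintro ⟨s, v⟩ hs
    -- A strategy has to be legal on all histories, so outside the closed set an arbitrary rule is
    -- taken.
    by_cases hc : I s v
    · obtain ⟨l, t, h1, h2⟩ := hI.some hs hc
      exact ⟨(t, v + l), ⟨l, h1, rfl⟩, fun _ => h2⟩
    · obtain ⟨l, t, h1⟩ := G.total s (.inl hs)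
      exact ⟨(t, v + l), ⟨l, h1, rfl⟩, fun h => (hc h).elim⟩
  choose! f hf hfI using hmove
  -- The default value concerns only the empty history, on which a strategy is never consulted.
  refine ⟨fun h => f (h.getLastD (0, 0)), fun h c hc => ?_, fun c hc hσ => ?_⟩
  · simpa using hf c hc
  · have hinv : ∀ i, I (c i).1 (c i).2 := by
      intro i
      induction i with
      | zero => simpa [hc.init] using h
      | succ i ih =>
        rcases hI.state ih with h0 | h1 | h2
        · have := hσ i h0
          simp only [List.range_succ, List.map_append, List.map_cons, List.map_nil,
            List.getLastD_concat] at this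
          rw [this]
          exact hfI _ h0 ih
        · obtain ⟨l, h2, h3⟩ := hc.move i fun h => G.final_not_mem₁ (h ▸ h1)
          rw [h3]
          exact hI.every h1 ih h2
        · rwa [hc.stay i h2]
    by_cases hfin : ∃ i, (c i).1 = G.final
    · obtain ⟨i, hi⟩ := hfin
      have := hinv i
      rw [hi] at this
      exact .inl ⟨i, Prod.ext hi (hI.final this)⟩
    · exact .inr fun i hi => hfin ⟨i, hi⟩

variable (G) in
/-- The configuration `d` is reached after `i` moves of a play in which Player 0 follows `σ`. -/
def ReachedIn (σ : List (ℕ × ℕ) → ℕ × ℕ) (c : ℕ → ℕ × ℕ) (i : ℕ) (d : ℕ × ℕ) : Prop :=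
  c 0 = (G.start, 0) ∧ c i = d ∧ ∀ j < i, (c j).1 ≠ G.final ∧ G.Move (c j) (c (j + 1)) ∧
    ((c j).1 ∈ G.S₀ → c (j + 1) = σ ((List.range (j + 1)).map c))

theorem ReachedIn.extend {σ c i d e} (h : G.ReachedIn σ c i d) (hd : d.1 ≠ G.final)
    (he : G.Move d e) (hσ : d.1 ∈ G.S₀ → e = σ ((List.range (i + 1)).map c)) :
    ∃ c', G.ReachedIn σ c' (i + 1) e := by
  obtain ⟨h0, rfl, h⟩ := h
  have hc : ∀ {j}, j ≤ i → (if j ≤ i then c j else e) = c j := fun hj => if_pos hj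
  have hmap : ∀ {j}, j ≤ i → (List.range (j + 1)).map (fun j => if j ≤ i then c j else e) =
      (List.range (j + 1)).map c := fun hj =>
    List.map_congr_left fun k hk => hc (by have := List.mem_range.1 hk; omega)
  refine ⟨fun j => if j ≤ i then c j else e, by simpa using h0, by simp, fun j hj => ?_⟩
  rw [hmap (by omega : j ≤ i)]
  simp only [hc (by omega : j ≤ i)]
  rcases Nat.lt_succ_iff_lt_or_eq.1 hj with hj | rfl
  · rw [hc (by omega : j + 1 ≤ i)]
    exact h j hj
  · rw [if_neg (by omega)]
    exact ⟨hd, he, hσ⟩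

/-- The closed set consists of the configurations reachable by finite plays that follow the winning
strategy. They are recorded with their histories, since the strategy may use memory. -/
theorem closed_of_playerZeroWins (h : G.PlayerZeroWins) : ∃ I, G.Closed I ∧ I G.start 0 := by
  obtain ⟨σ, hσ, hwin⟩ := h
  refine ⟨fun s v => ∃ c i, G.ReachedIn σ c i (s, v), ⟨?_, ?_, ?_, ?_⟩,
    fun _ => (G.start, 0), 0, rfl, rfl, by simp⟩
  · rintro s v ⟨c, i, h0, hi, h⟩
    cases i with
    | zero =>
      obtain ⟨rfl, -⟩ := Prod.mk.inj (h0.symm.trans hi)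
      exact G.start_mem.imp_right .inl
    | succ i =>
      obtain ⟨l, hl, -⟩ := (h i (by omega)).2.1
      rw [hi] at hl
      exact G.target_mem _ _ _ hl
  · rintro s v hs ⟨c, i, h⟩
    have hm : G.Move (s, v) (σ ((List.range (i + 1)).map c)) := by
      rw [List.range_succ, List.map_append, List.map_singleton, h.2.1]
      exact hσ _ _ hs
    obtain ⟨c', hc'⟩ := h.extend (fun h => G.final_not_mem₀ (h ▸ hs)) hm fun _ => rfl
    obtain ⟨l, h1, h2⟩ := hm
    refine ⟨l, _, h1, c', i + 1, ?_⟩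
    rwa [← h2]
  · rintro s v l t hs ⟨c, i, h⟩ hr
    obtain ⟨c', hc'⟩ := h.extend (e := (t, v + l)) (fun h => G.final_not_mem₁ (h ▸ hs))
      ⟨l, hr, rfl⟩ fun h => (G.disjoint s h hs).elim
    exact ⟨c', _, hc'⟩
  · rintro v ⟨c, i, h0, hi, h⟩
    -- A finite play that has reached the final state becomes an infinite one by repeating its last
    -- configuration; the winning condition then yields the value.
    have hplay : G.IsPlay fun j => c (min j i) := by
      refine ⟨by simpa using h0, fun j hj => ?_, fun j hj => ?_⟩
      · have hji : j < i := by
          by_contra hji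
          rw [min_eq_right (by omega), hi] at hj
          exact hj rfl
        simp only [min_eq_left hji.le, min_eq_left (show j + 1 ≤ i from hji)]
        exact (h j hji).2.1
      · have hji : i ≤ j := by
          by_contra hji
          rw [min_eq_left (by omega)] at hj
          exact (h j (by omega)).1 hj
        simp only [min_eq_right hji, min_eq_right (show i ≤ j + 1 by omega)]
    have hfol : G.Follows σ fun j => c (min j i) := by
      intro j hj
      change (c (min j i)).1 ∈ G.S₀ at hj
      have hji : j < i := by
        by_contra hji
        rw [min_eq_right (by omega), hi] at hj
        exact G.final_not_mem₀ hj
      simp only [min_eq_left hji.le] at hj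
      simp only [min_eq_left (show j + 1 ≤ i from hji)]
      rw [(h j hji).2.2 hj]
      congr 1
      refine List.map_congr_left fun k hk => ?_
      rw [min_eq_left (by have := List.mem_range.1 hk; omega)]
    rcases hwin _ hplay hfol with ⟨j, hj⟩ | hj
    · change c (min j i) = (G.final, G.finalValue) at hj
      by_cases hji : j < i
      · rw [min_eq_left hji.le] at hj
        exact ((h j hji).1 (by rw [hj])).elim
      · rw [min_eq_right (by omega), hi] at hj
        exact (Prod.mk.inj hj).2
    · exact (hj i (by simp [hi])).elim

/-- The reduction is correct. -/
theorem toInstance_correct {ν : Sym → ℕ} (hν : ν.Injective) :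
    (G.toInstance ν).sys.Normed ∧
      (G.PlayerZeroWins ↔ (G.toInstance ν).sys.BranchingBisimilar (G.toInstance ν).left
        (G.toInstance ν).right) ∧
      ((G.toInstance ν).sys.BranchingBisimilar (G.toInstance ν).left (G.toInstance ν).right ↔
        (G.toInstance ν).sys.WeaklyBisimilar (G.toInstance ν).left (G.toInstance ν).right) := by
  have h1 : G.PlayerZeroWins → (G.toInstance ν).sys.BranchingBisimilar (G.toInstance ν).left
      (G.toInstance ν).right := fun h =>
    let ⟨_, hI, h⟩ := closed_of_playerZeroWins h
    branchingBisimilar_of_closed hν hI h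
  have h2 : (G.toInstance ν).sys.WeaklyBisimilar (G.toInstance ν).left (G.toInstance ν).right →
      G.PlayerZeroWins := fun h =>
    let ⟨_, hI, h⟩ := closed_of_weaklyBisimilar hν h
    playerZeroWins_of_closed hI h
  exact ⟨normed_toSystem, ⟨h1, fun h => h2 h.weakly⟩, fun h => h.weakly, fun h => h1 (h2 h)⟩

end HitOrRunGame

/-! ### Programs for machines with stacks -/

namespace StackProgram

open Function TM2.Stmt

/-- `f` leads from `c` to `d` in at most `t` steps. -/
def ReachesIn {C : Type} (f : C → Option C) (t : ℕ) (c d : C) : Prop :=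
  ∃ m ≤ t, (flip bind f)^[m] (some c) = some d

theorem ReachesIn.step {C : Type} {f : C → Option C} {c d : C} (h : f c = some d) :
    ReachesIn f 1 c d := ⟨1, le_rfl, by simpa [flip] using h⟩

theorem ReachesIn.trans {C : Type} {f : C → Option C} {t₁ t₂ : ℕ} {c d e : C}
    (h₁ : ReachesIn f t₁ c d) (h₂ : ReachesIn f t₂ d e) : ReachesIn f (t₁ + t₂) c e := by
  obtain ⟨m₁, h1, h2⟩ := h₁
  obtain ⟨m₂, h3, h4⟩ := h₂
  exact ⟨m₂ + m₁, by omega, by rw [iterate_add_apply, h2, h4]⟩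

theorem ReachesIn.mono {C : Type} {f : C → Option C} {t₁ t₂ : ℕ} {c d : C}
    (h : ReachesIn f t₁ c d) (ht : t₁ ≤ t₂) : ReachesIn f t₂ c d :=
  let ⟨m, h1, h2⟩ := h
  ⟨m, h1.trans ht, h2⟩

/-- The contents of the stacks. -/
abbrev Stacks := ℕ → List Γ'

abbrev Stmt (Λ : Type) := TM2.Stmt (fun _ : ℕ => Γ') Λ (Option Γ')

abbrev Cfg (Λ : Type) := TM2.Cfg (fun _ : ℕ => Γ') Λ (Option Γ')

/-- A piece of a program with one entry and one exit. -/
structure Block where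
  Lab : Type
  fin : Fintype Lab
  entry : Lab
  code : ∀ Λ : Type, (Lab → Λ) → Λ → Lab → Stmt Λ

/-- `B` is a part of the program `M`. -/
def Block.PartOf (B : Block) {Λ : Type} (M : Λ → Stmt Λ) (emb : B.Lab → Λ) (exit : Λ) : Prop :=
  ∀ l, M (emb l) = B.code Λ emb exit l

/-- `B` transforms the stacks `S` into `S'` in at most `t` steps. -/
def Block.Runs (B : Block) (S S' : Stacks) (t : ℕ) : Prop :=
  ∀ (Λ : Type) (M : Λ → Stmt Λ) (emb : B.Lab → Λ) (exit : Λ), B.PartOf M emb exit →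
    ∀ v, ∃ v', ReachesIn (TM2.step M) t (⟨some (emb B.entry), v, S⟩ : Cfg Λ) ⟨some exit, v', S'⟩

theorem Block.Runs.mono {B : Block} {S S' : Stacks} {t t' : ℕ} (h : B.Runs S S' t) (ht : t ≤ t') :
    B.Runs S S' t' := fun Λ M emb exit hM v =>
  let ⟨v', h⟩ := h Λ M emb exit hM v
  ⟨v', h.mono ht⟩

def Block.seq (A B : Block) : Block where
  Lab := A.Lab ⊕ B.Lab
  fin := @instFintypeSum _ _ A.fin B.fin
  entry := .inl A.entry
  code Λ emb exit
    | .inl l => A.code Λ (emb ∘ .inl) (emb (.inr B.entry)) l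
    | .inr l => B.code Λ (emb ∘ .inr) exit l

theorem Block.Runs.seq {A B : Block} {S₁ S₂ S₃ : Stacks} {t₁ t₂ : ℕ} (hA : A.Runs S₁ S₂ t₁)
    (hB : B.Runs S₂ S₃ t₂) : (A.seq B).Runs S₁ S₃ (t₁ + t₂) := by
  intro Λ M emb exit hM v
  obtain ⟨v₁, h1⟩ := hA Λ M (emb ∘ .inl) (emb (.inr B.entry)) (fun l => hM (.inl l)) v
  obtain ⟨v₂, h2⟩ := hB Λ M (emb ∘ .inr) exit (fun l => hM (.inr l)) v₁
  exact ⟨v₂, h1.trans h2⟩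

def Block.nop : Block where
  Lab := Unit
  fin := inferInstance
  entry := ()
  code _ _ exit _ := goto fun _ => exit

theorem Block.runs_nop (S : Stacks) : Block.nop.Runs S S 1 := by
  intro Λ M emb exit hM v
  refine ⟨v, .step ?_⟩
  rw [TM2.step, hM]
  rfl

def Block.push (r : ℕ) (c : Γ') : Block where
  Lab := Unit
  fin := inferInstance
  entry := ()
  code _ _ exit _ := TM2.Stmt.push r (fun _ => c) (goto fun _ => exit)

theorem Block.runs_push (r : ℕ) (c : Γ') (S : Stacks) :
    (Block.push r c).Runs S (update S r (c :: S r)) 1 := by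
  intro Λ M emb exit hM v
  refine ⟨v, .step ?_⟩
  rw [TM2.step, hM]
  rfl

/-- Pop symbols from the stack `r` until it is empty, executing `body q c` for each symbol `c`,
where `q` is the state of a finite automaton that reads these symbols. -/
def Block.loop {Q : Type} [Fintype Q] (r : ℕ) (δ : Q → Γ' → Q) (q₀ : Q) (body : Q → Γ' → Block) :
    Block where
  Lab := Q ⊕ Σ x : Q × Γ', (body x.1 x.2).Lab
  fin :=
    letI : ∀ x : Q × Γ', Fintype (body x.1 x.2).Lab := fun x => (body x.1 x.2).fin
    inferInstance
  entry := .inl q₀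
  code Λ emb exit
    | .inl q => TM2.Stmt.pop r (fun _ c => c) (goto fun v => match v with
        | none => exit
        | some c => emb (.inr ⟨(q, c), (body q c).entry⟩))
    | .inr ⟨x, l⟩ => (body x.1 x.2).code Λ (fun l => emb (.inr ⟨x, l⟩)) (emb (.inl (δ x.1 x.2))) l

/-- A round costs one step for the pop and at most `t` for the body; one more step detects the empty
stack. The automaton state is kept in the labels, so the induction varies the entry point, and the
final stacks are chosen before the surrounding program is given. -/
theorem Block.runs_loop {Q : Type} [Fintype Q] {r : ℕ} {δ : Q → Γ' → Q} {q₀ : Q}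
    {body : Q → Γ' → Block} {I : Q → List Γ' → Stacks → Prop} {t : ℕ}
    (hr : ∀ q s S, I q s S → S r = s)
    (hbody : ∀ q c s S, I q (c :: s) S →
      ∃ S', (body q c).Runs (update S r s) S' t ∧ I (δ q c) s S')
    {s : List Γ'} {S : Stacks} (h : I q₀ s S) :
    ∃ q' S', I q' [] S' ∧ (Block.loop r δ q₀ body).Runs S S' (s.length * (t + 1) + 1) := by
  suffices key : ∀ s q S, I q s S → ∃ q' S', I q' [] S' ∧
      ∀ (Λ : Type) (M : Λ → Stmt Λ) (emb : (Q ⊕ Σ x : Q × Γ', (body x.1 x.2).Lab) → Λ) (exit : Λ),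
        (Block.loop r δ q₀ body).PartOf M emb exit → ∀ v, ∃ v', ReachesIn (TM2.step M)
          (s.length * (t + 1) + 1) (⟨some (emb (Sum.inl q)), v, S⟩ : Cfg Λ) ⟨some exit, v', S'⟩ by
    exact key s q₀ S h
  intro s
  induction s with
  | nil =>
    intro q S h
    refine ⟨q, S, h, fun Λ M emb exit hM v => ⟨none, ?_⟩⟩
    refine .mono (.step ?_) (Nat.le_add_left _ _)
    have hS := hr q _ S h
    have hup : update S r [] = S := by rw [← hS, update_eq_self]
    rw [TM2.step, hM (Sum.inl q)]
    simp only [Block.loop, TM2.stepAux, hS, List.head?_nil, List.tail_nil, hup]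
  | cons c s ih =>
    intro q S h
    have hS := hr q _ S h
    obtain ⟨S₁, h1, h2⟩ := hbody q c s S h
    obtain ⟨q', S', h3, h4⟩ := ih _ S₁ h2
    refine ⟨q', S', h3, fun Λ M emb exit hM v => ?_⟩
    obtain ⟨v₁, h5⟩ := h1 Λ M (fun l => emb (Sum.inr ⟨(q, c), l⟩)) (emb (Sum.inl (δ q c)))
      (fun l => hM (Sum.inr ⟨(q, c), l⟩)) (some c)
    obtain ⟨v₂, h6⟩ := h4 Λ M emb exit hM v₁
    refine ⟨v₂, (((ReachesIn.step ?_).trans h5).trans h6).mono ?_⟩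
    · rw [TM2.step, hM (Sum.inl q)]
      simp only [Block.loop, TM2.stepAux, hS, List.head?_cons, List.tail_cons]
    · rw [List.length_cons]
      ring_nf
      omega

/-- Move the contents of the stack `r` to the stacks in `rs`, reversing them. -/
def Block.pushAll (rs : List ℕ) (c : Γ') : Block :=
  rs.foldr (fun r B => (Block.push r c).seq B) Block.nop

/-- No target stack means clearing, and two targets produce a second copy; moving reverses, so two
moves in succession restore the order. -/
def Block.move (r : ℕ) (rs : List ℕ) : Block :=
  Block.loop (Q := Unit) r (fun q _ => q) () fun _ c => Block.pushAll rs c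

theorem Block.runs_clear (r : ℕ) (S : Stacks) :
    (Block.move r []).Runs S (update S r []) (2 * (S r).length + 1) := by
  obtain ⟨-, S', rfl, h⟩ := Block.runs_loop (r := r) (δ := fun (q : Unit) _ => q) (q₀ := ())
    (body := fun _ c => Block.pushAll [] c) (t := 1)
    (I := fun _ s S' => S' = update S r s) (S := S) (s := S r) (by rintro - s S' rfl; simp)
    (by rintro - c s S' rfl; exact ⟨_, Block.runs_nop _, by simp⟩) (by simp)
  exact Block.Runs.mono h (by omega)

theorem Block.runs_move {r r₁ : ℕ} (hr : r₁ ≠ r) (S : Stacks) :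
    (Block.move r [r₁]).Runs S (update (update S r []) r₁ ((S r).reverse ++ S r₁))
      (3 * (S r).length + 1) := by
  obtain ⟨-, S', ⟨p, hp, rfl⟩, h⟩ := Block.runs_loop (r := r) (δ := fun (q : Unit) _ => q) (q₀ := ())
    (body := fun _ c => Block.pushAll [r₁] c) (t := 2)
    (I := fun _ s S' => ∃ p, S r = p ++ s ∧
      S' = update (update S r s) r₁ (p.reverse ++ S r₁)) (S := S) (s := S r)
    (by rintro - s S' ⟨p, hp, rfl⟩; rw [update_of_ne hr.symm, update_self])
    (by
      rintro - c s S' ⟨p, hp, rfl⟩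
      refine ⟨_, (Block.runs_push _ _ _).seq (Block.runs_nop _), p ++ [c], by simp [hp], ?_⟩
      funext k
      by_cases h1 : k = r₁
      · subst h1; simp [hr]
      · by_cases h2 : k = r
        · subst h2; simp [h1]
        · simp [h1, h2])
    ⟨[], by simp, by simp⟩
  rw [List.append_nil] at hp
  rw [hp]
  rw [hp] at h
  exact Block.Runs.mono h (by omega)

theorem Block.runs_move₂ {r r₁ r₂ : ℕ} (hr₁ : r₁ ≠ r) (hr₂ : r₂ ≠ r) (h₁₂ : r₁ ≠ r₂) (S : Stacks) :
    (Block.move r [r₁, r₂]).Runs S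
      (update (update (update S r []) r₁ ((S r).reverse ++ S r₁)) r₂ ((S r).reverse ++ S r₂))
      (4 * (S r).length + 1) := by
  obtain ⟨-, S', ⟨p, hp, rfl⟩, h⟩ := Block.runs_loop (r := r) (δ := fun (q : Unit) _ => q) (q₀ := ())
    (body := fun _ c => Block.pushAll [r₁, r₂] c) (t := 3)
    (I := fun _ s S' => ∃ p, S r = p ++ s ∧
      S' = update (update (update S r s) r₁ (p.reverse ++ S r₁)) r₂ (p.reverse ++ S r₂))
    (S := S) (s := S r)
    (by rintro - s S' ⟨p, hp, rfl⟩; rw [update_of_ne hr₂.symm, update_of_ne hr₁.symm, update_self])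
    (by
      rintro - c s S' ⟨p, hp, rfl⟩
      refine ⟨_, (Block.runs_push _ _ _).seq ((Block.runs_push _ _ _).seq (Block.runs_nop _)),
        p ++ [c], by simp [hp], ?_⟩
      funext k
      by_cases h1 : k = r₁
      · subst h1; simp [hr₁, h₁₂]
      · by_cases h2 : k = r₂
        · subst h2; simp [h1, hr₂]
        · by_cases h3 : k = r
          · subst h3; simp [h1, h2]
          · simp [h1, h2, h3])
    ⟨[], by simp, by simp⟩
  rw [List.append_nil] at hp
  rw [hp]
  rw [hp] at h
  exact Block.Runs.mono h (by omega)

/-! ### Computable word functions -/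

/-- Extend an environment by a word. -/
def cons {X : Type} (x : X) (e : ℕ → X) : ℕ → X
  | 0 => x
  | i + 1 => e i

/-- Given the words `π a i`, a program writes the word `g a` in polynomial time. -/
def Emits {A : Type} (π : A → ℕ → List Γ') (g : A → List Γ') : Prop :=
  ∃ P : Polynomial ℕ, (∀ a N, (∀ i, (π a i).length ≤ N) → (g a).length ≤ P.eval N) ∧
    ∀ (ρ : ℕ → ℕ) (dst base : ℕ), (∀ i, ρ i < base) → dst < base → (∀ i, ρ i ≠ dst) →
      ∃ B : Block, ∀ a S N, (∀ i, S (ρ i) = π a i) → (∀ r, base ≤ r → S r = []) →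
        (∀ i, (π a i).length ≤ N) →
        B.Runs S (update S dst ((g a).reverse ++ S dst)) (P.eval N)

namespace Emits

variable {A : Type} {π : A → ℕ → List Γ'} {g h : A → List Γ'}

theorem congr (hg : Emits π g) (e : ∀ a, g a = h a) : Emits π h := by
  rwa [← funext e]

theorem nil : Emits π fun _ => [] :=
  ⟨1, by simp, fun ρ dst base _ _ _ => ⟨.nop, fun a S N _ _ _ => by
    simpa using Block.runs_nop S⟩⟩

theorem symbol (c : Γ') : Emits π fun _ => [c] :=
  ⟨1, by simp, fun ρ dst base _ _ _ => ⟨.push dst c, fun a S N _ _ _ => by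
    simpa using Block.runs_push dst c S⟩⟩

/-- Outputs are pushed on the destination stack and hence lie there in reverse, so running one
program after the other concatenates their outputs. -/
theorem append (hg : Emits π g) (hh : Emits π h) : Emits π fun a => g a ++ h a := by
  obtain ⟨P, hP, hg⟩ := hg
  obtain ⟨P', hP', hh⟩ := hh
  refine ⟨P + P', fun a N hN => ?_, fun ρ dst base h1 h2 h3 => ?_⟩
  · simpa using Nat.add_le_add (hP a N hN) (hP' a N hN)
  · obtain ⟨B, hB⟩ := hg ρ dst base h1 h2 h3
    obtain ⟨B', hB'⟩ := hh ρ dst base h1 h2 h3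
    refine ⟨B.seq B', fun a S N h4 h5 h6 => ?_⟩
    have := (hB a S N h4 h5 h6).seq (hB' a _ N (fun i => by rw [update_of_ne (h3 i), h4])
      (fun r hr => by rw [update_of_ne (by omega), h5 r hr]) h6)
    simpa using this

theorem const (w : List Γ') : Emits π fun _ => w := by
  induction w with
  | nil => exact nil
  | cons c w ih => exact (symbol c).append ih

/-- `Emits` quantifies over all assignments of input stacks, not necessarily injective ones, so
inputs can be renamed, duplicated or ignored at no cost. -/
theorem comap {A' : Type} {π' : A' → ℕ → List Γ'} (hg : Emits π g) (k : A' → A) (f : ℕ → ℕ)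
    (hf : ∀ a i, π (k a) i = π' a (f i)) : Emits π' fun a => g (k a) := by
  obtain ⟨P, hP, hg⟩ := hg
  refine ⟨P, fun a N hN => hP _ N fun i => by rw [hf]; exact hN _, fun ρ dst base h1 h2 h3 => ?_⟩
  obtain ⟨B, hB⟩ := hg (ρ ∘ f) dst base (fun i => h1 _) h2 (fun i => h3 _)
  exact ⟨B, fun a S N h4 h5 h6 => hB _ S N (fun i => by rw [hf, ← h4]; rfl) h5
    fun i => by rw [hf]; exact h6 _⟩

/-- A local definition: `g` is written to scratch stack `base`, turned around onto `base + 1`, used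
there as input number 0 of `h`, and finally cleared. -/
theorem bind (hg : Emits π g) (hh : Emits (fun a => cons (g a) (π a)) h) : Emits π h := by
  obtain ⟨P, hP, hg⟩ := hg
  obtain ⟨P', hP', hh⟩ := hh
  have hlen : ∀ {a N}, (∀ i, (π a i).length ≤ N) → ∀ i, (cons (g a) (π a) i).length ≤ N + P.eval N := by
    rintro a N hN (_ | i)
    · exact (hP a N hN).trans (Nat.le_add_left _ _)
    · exact (hN i).trans (Nat.le_add_right _ _)
  -- The summands are the costs of these four blocks. The inputs of `h` include the word `g a`, so
  -- their length is bounded by N + P(N).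
  refine ⟨P + (3 * P + 1) + P'.comp (Polynomial.X + P) + (2 * P + 1), fun a N hN => ?_,
    fun ρ dst base h1 h2 h3 => ?_⟩
  · have := hP' a _ (hlen hN)
    simp only [Polynomial.eval_add, Polynomial.eval_comp, Polynomial.eval_X]
    omega
  · obtain ⟨B, hB⟩ := hg ρ base (base + 1) (fun i => (h1 i).trans (Nat.lt_succ_self _))
      (Nat.lt_succ_self _) (fun i => (h1 i).ne)
    obtain ⟨B', hB'⟩ := hh (cons (base + 1) ρ) dst (base + 2)
      (by rintro (_ | i); exacts [Nat.lt_succ_self _, (h1 i).trans (by omega)])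
      (by omega) (by rintro (_ | i); exacts [by simp only [cons]; omega, h3 i])
    refine ⟨B.seq ((Block.move base [base + 1]).seq (B'.seq (Block.move (base + 1) []))),
      fun a S N h4 h5 h6 => ?_⟩
    have r1 := hB a S N h4 (fun r hr => h5 r (by omega)) h6
    rw [h5 base le_rfl, List.append_nil] at r1
    have r2 := Block.runs_move (r := base) (r₁ := base + 1) (by omega)
      (update S base (g a).reverse)
    rw [update_self, List.reverse_reverse, update_of_ne (by omega), h5 (base + 1) (by omega),
      List.append_nil, List.length_reverse] at r2
    have e2 : update (update (update S base (g a).reverse) base []) (base + 1) (g a) =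
        update S (base + 1) (g a) := by
      rw [update_idem, ← h5 base le_rfl, update_eq_self]
    rw [e2] at r2
    have r3 := hB' a (update S (base + 1) (g a)) (N + P.eval N)
      (by
        rintro (_ | i)
        · simp [cons]
        · have := h1 i
          simp only [cons]
          rw [update_of_ne (by omega), h4])
      (fun r hr => by rw [update_of_ne (by omega), h5 r (by omega)]) (hlen h6)
    have r4 := Block.runs_clear (base + 1) (update (update S (base + 1) (g a)) dst
      ((h a).reverse ++ S dst))
    have e4 : update (update (update S (base + 1) (g a)) dst ((h a).reverse ++ S dst)) (base + 1) [] =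
        update S dst ((h a).reverse ++ S dst) := by
      funext k
      by_cases hk : k = base + 1
      · subst hk
        rw [update_self, update_of_ne (by omega), h5 _ (by omega)]
      · by_cases hk' : k = dst
        · subst hk'; simp [hk]
        · simp [hk, hk']
    rw [e4, update_of_ne (by omega), update_self] at r4
    rw [update_of_ne (by omega : dst ≠ base + 1)] at r3
    have := r1.seq (r2.seq (r3.seq r4))
    refine Block.Runs.mono this ?_
    have := hP a N h6
    simp only [Polynomial.eval_add, Polynomial.eval_comp, Polynomial.eval_X, Polynomial.eval_mul,
      Polynomial.eval_one, Polynomial.eval_ofNat]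
    omega

end Emits

end StackProgram

/-! ### Loops over the symbols of a word -/

namespace StackProgram

open Function TM2.Stmt

/-- Read a word with a finite automaton and concatenate the words `o q c p s`, where `q` is the
state, `c` the current symbol, `s` the remaining word and `p` the reverse of the word before `c`. -/
def scanOut {Q : Type} (δ : Q → Γ' → Q) (o : Q → Γ' → List Γ' → List Γ' → List Γ') :
    Q → List Γ' → List Γ' → List Γ'
  | _, _, [] => []
  | q, p, c :: s => o q c p s ++ scanOut δ o (δ q c) (c :: p) s

/-- Scanning needs two scratch stacks, holding the unread rest and the reversed read part; the body
receives both as inputs 0 and 1. The invariant `I` restricts the domain of the body, which then has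
to be correct only for situations that occur in the scan. -/
theorem Emits.scan {A Q : Type} [Fintype Q] {π : A → ℕ → List Γ'} (i : ℕ) (δ : Q → Γ' → Q) (q₀ : Q)
    {o : A → Q → Γ' → List Γ' → List Γ' → List Γ'} (I : A → Q → List Γ' → List Γ' → Prop)
    (h₀ : ∀ a, I a q₀ [] (π a i))
    (hδ : ∀ a q p c s, I a q p (c :: s) → I a (δ q c) (c :: p) s)
    (hbody : ∀ q c, Emits (A := {x : A × List Γ' × List Γ' // I x.1 q x.2.1 (c :: x.2.2)})
      (fun x => cons x.1.2.2 (cons x.1.2.1 (π x.1.1))) fun x => o x.1.1 q c x.1.2.1 x.1.2.2) :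
    Emits π fun a => scanOut δ (o a) q₀ [] (π a i) := by
  choose P hP hB using hbody
  -- There are only finitely many pairs of a state and a symbol, so the sum of the bounds of all
  -- bodies is a common bound.
  set PP : Polynomial ℕ := ∑ x : Q × Γ', P x.1 x.2 with hPP
  have hle : ∀ q c N, (P q c).eval N ≤ PP.eval N := fun q c N => by
    rw [hPP, Polynomial.eval_finsetSum]
    exact Finset.single_le_sum (f := fun x : Q × Γ' => (P x.1 x.2).eval N) (fun _ _ => Nat.zero_le _)
      (Finset.mem_univ (q, c))
  have henv : ∀ {a N} {p s : List Γ'}, (∀ j, (π a j).length ≤ N) → p.length + s.length ≤ N →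
      ∀ j, (cons s (cons p (π a)) j).length ≤ N := by
    rintro a N p s hN h (_ | _ | j)
    · exact (Nat.le_add_left _ _).trans h
    · exact (Nat.le_add_right _ _).trans h
    · exact hN j
  have hlen : ∀ a N, (∀ j, (π a j).length ≤ N) → ∀ s q p, I a q p s → p.length + s.length ≤ N →
      (scanOut δ (o a) q p s).length ≤ s.length * PP.eval N := by
    intro a N hN s
    induction s with
    | nil => simp [scanOut]
    | cons c s ih =>
      intro q p hI h
      simp only [List.length_cons] at h
      have h1 := ih _ _ (hδ _ _ _ _ _ hI) (by simp only [List.length_cons]; omega)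
      have h2 : (o a q c p s).length ≤ PP.eval N :=
        (hP q c ⟨(a, p, s), hI⟩ N (henv (p := p) (s := s) hN (by omega))).trans (hle q c N)
      simp only [scanOut, List.length_append, List.length_cons, Nat.add_mul, one_mul] at h2 ⊢
      omega
  -- The first summand bounds the output length; the others are the costs of the four blocks.
  refine ⟨Polynomial.X * PP + (3 * Polynomial.X + 1) + (4 * Polynomial.X + 1) +
    (Polynomial.X * (PP + 1 + 1) + 1) + (2 * Polynomial.X + 1), fun a N hN => ?_,
    fun ρ dst base h1 h2 h3 => ?_⟩
  · have := (hlen a N hN _ _ _ (h₀ a) (by simpa using hN i)).trans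
      (Nat.mul_le_mul_right (PP.eval N) (hN i))
    simp only [Polynomial.eval_add, Polynomial.eval_mul, Polynomial.eval_X]
    omega
  choose B hB using fun q c => hB q c (cons (base + 1) (cons base ρ)) dst (base + 2)
    (by rintro (_ | _ | j); exacts [Nat.lt_succ_self _, by simp only [cons]; omega, (h1 j).trans (by omega)])
    (by omega) (by rintro (_ | _ | j); exacts [by simp only [cons]; omega, by simp only [cons]; omega, h3 j])
  -- Moving the input to `base` and back to two stacks restores it and leaves a copy on `base + 1`
  -- for the loop to consume.
  refine ⟨(Block.move (ρ i) [base]).seq ((Block.move base [ρ i, base + 1]).seq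
    ((Block.loop (base + 1) δ q₀ fun q c => (B q c).seq (Block.push base c)).seq
      (Block.move base []))), fun a S N h4 h5 h6 => ?_⟩
  have hi := h1 i
  have hb : S base = [] := h5 _ le_rfl
  have hb' : S (base + 1) = [] := h5 _ (by omega)
  have r1 := Block.runs_move (r := ρ i) (r₁ := base) (by omega) S
  rw [h4, hb, List.append_nil] at r1
  have r2 := Block.runs_move₂ (r := base) (r₁ := ρ i) (r₂ := base + 1) (by omega) (by omega) (by omega)
    (update (update S (ρ i) []) base (π a i).reverse)
  have e2 : update (update (update (update (update S (ρ i) []) base (π a i).reverse) base []) (ρ i)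
      (π a i)) (base + 1) (π a i) = update S (base + 1) (π a i) := by
    funext k
    by_cases k1 : k = base + 1
    · subst k1; simp
    · by_cases k2 : k = ρ i
      · subst k2; simp [k1, h4]
      · by_cases k3 : k = base
        · subst k3; simp [k2, hb]
        · simp [k1, k2, k3]
  rw [update_self, List.reverse_reverse, update_of_ne (by omega : ρ i ≠ base), update_self,
    update_of_ne (by omega : base + 1 ≠ base), update_of_ne (by omega : base + 1 ≠ ρ i), hb',
    List.append_nil, e2, List.length_reverse] at r2
  set out := scanOut δ (o a) q₀ [] (π a i) with hout
  -- The stacks during the loop, with unread rest `s`, reversed read part `p` and output `x` so far.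
  let T (s p x : List Γ') : Stacks :=
    update (update (update S (base + 1) s) base p) dst (x.reverse ++ S dst)
  have T1 : ∀ s p x, T s p x (base + 1) = s := fun s p x => by
    simp only [T]
    rw [update_of_ne (by omega), update_of_ne (by omega), update_self]
  have T2 : ∀ s p x, T s p x base = p := fun s p x => by
    simp only [T]
    rw [update_of_ne (by omega), update_self]
  have T3 : ∀ s p x s', update (T s p x) (base + 1) s' = T s' p x := fun s p x s' => by
    simp only [T]
    rw [update_comm (by omega : dst ≠ base + 1), update_comm (by omega : base ≠ base + 1),
      update_idem]
  have T4 : ∀ s p x p', update (T s p x) base p' = T s p' x := fun s p x p' => by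
    simp only [T]
    rw [update_comm (by omega : dst ≠ base), update_idem]
  obtain ⟨q', S', ⟨p, x, hI, hps, hx, rfl⟩, r3⟩ := Block.runs_loop (r := base + 1) (δ := δ) (q₀ := q₀)
    (body := fun q c => (B q c).seq (Block.push base c))
    (I := fun q s S' => ∃ p x, I a q p s ∧ p.length + s.length = (π a i).length ∧
      x ++ scanOut δ (o a) q p s = out ∧ S' = T s p x)
    (t := PP.eval N + 1) (s := π a i) (S := update S (base + 1) (π a i))
    (by rintro q s S' ⟨p, x, -, -, -, rfl⟩; exact T1 _ _ _)
    (by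
      rintro q c s S' ⟨p, x, hI, hps, hx, rfl⟩
      have hN : p.length + s.length ≤ N := by
        have := h6 i
        simp only [List.length_cons] at hps
        omega
      have rb := hB q c ⟨(a, p, s), hI⟩ (T s p x) N
        (by
          rintro (_ | _ | j)
          · exact T1 _ _ _
          · exact T2 _ _ _
          · have := h1 j
            simp only [cons, T]
            rw [update_of_ne (h3 j), update_of_ne (by omega), update_of_ne (by omega), h4])
        (fun r hr => by
          simp only [T]
          rw [update_of_ne (by omega), update_of_ne (by omega), update_of_ne (by omega),
            h5 r (by omega)])
        (henv h6 hN)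
      have eb : update (T s p x) dst ((o a q c p s).reverse ++ T s p x dst) =
          T s p (x ++ o a q c p s) := by
        simp only [T]
        rw [update_self, update_idem, List.reverse_append, List.append_assoc]
      rw [eb] at rb
      have := (rb.mono (hle q c N)).seq (Block.runs_push base c (T s p (x ++ o a q c p s)))
      rw [T2, T4] at this
      refine ⟨_, by rw [T3]; exact this, c :: p, x ++ o a q c p s, hδ _ _ _ _ _ hI, ?_, ?_, rfl⟩
      · simp only [List.length_cons] at hps ⊢
        omega
      · rw [← hx, scanOut, List.append_assoc])
    ⟨[], [], h₀ a, by simp, by simp [hout], by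
      simp only [T]
      rw [List.reverse_nil, List.nil_append, ← hb, ← update_of_ne (by omega : base ≠ base + 1)
        (π a i) S, update_eq_self, ← update_of_ne (by omega : dst ≠ base + 1) (π a i) S,
        update_eq_self]⟩
  have r4 := Block.runs_clear base (T [] p x)
  have e4 : T [] [] x = update S dst (x.reverse ++ S dst) := by
    simp only [T]
    rw [← hb', update_eq_self, hb', ← hb, update_eq_self]
  rw [T4, T2, e4] at r4
  simp only [scanOut, List.append_nil] at hx
  rw [hx] at r3 r4
  refine Block.Runs.mono (r1.seq (r2.seq (Block.Runs.seq r3 r4))) ?_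
  have h7 := h6 i
  simp only [List.length_nil, add_zero] at hps
  have h8 := Nat.mul_le_mul_right (PP.eval N + 1 + 1) h7
  simp only [Polynomial.eval_add, Polynomial.eval_mul, Polynomial.eval_X, Polynomial.eval_one,
    Polynomial.eval_ofNat]
  omega

/-! ### From programs to Turing machines -/

/-- All stacks of a statement have indices at most `bound`. -/
def bound {Λ : Type} : Stmt Λ → ℕ
  | .push k _ q => max k (bound q)
  | .peek k _ q => max k (bound q)
  | .pop k _ q => max k (bound q)
  | .load _ q => bound q
  | .branch _ q₁ q₂ => max (bound q₁) (bound q₂)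
  | .goto _ => 0
  | .halt => 0

/-- The statement with finitely many stacks. -/
def restrict {Λ : Type} (m : ℕ) : Stmt Λ → TM2.Stmt (fun _ : Fin (m + 1) => Γ') Λ (Option Γ')
  | .push k f q => .push (Fin.ofNat (m + 1) k) f (restrict m q)
  | .peek k f q => .peek (Fin.ofNat (m + 1) k) f (restrict m q)
  | .pop k f q => .pop (Fin.ofNat (m + 1) k) f (restrict m q)
  | .load f q => .load f (restrict m q)
  | .branch f q₁ q₂ => .branch f (restrict m q₁) (restrict m q₂)
  | .goto f => .goto f
  | .halt => .halt

def restrictCfg {Λ : Type} (m : ℕ) (c : Cfg Λ) :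
    TM2.Cfg (fun _ : Fin (m + 1) => Γ') Λ (Option Γ') :=
  ⟨c.l, c.var, fun k => c.stk k⟩

theorem update_restrict {m k : ℕ} (hk : k ≤ m) (S : Stacks) (x : List Γ') :
    update (fun k : Fin (m + 1) => S k) (Fin.ofNat (m + 1) k) x =
      fun k' : Fin (m + 1) => update S k x k' := by
  have h0 : ((Fin.ofNat (m + 1) k : Fin (m + 1)) : ℕ) = k := by
    simp [Fin.ofNat, Nat.mod_eq_of_lt (Nat.lt_succ_of_le hk)]
  funext k'
  by_cases h : (k' : ℕ) = k
  · obtain rfl : k' = Fin.ofNat (m + 1) k := Fin.ext (h.trans h0.symm)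
    rw [update_self, h, update_self]
  · rw [update_of_ne (fun h' => h (by rw [h', h0])), update_of_ne h]

theorem stepAux_restrict {Λ : Type} {m : ℕ} (q : Stmt Λ) (hq : bound q ≤ m) (v : Option Γ')
    (S : Stacks) : TM2.stepAux (restrict m q) v (fun k => S k) =
      restrictCfg m (TM2.stepAux q v S) := by
  have h0 : ∀ {k}, k ≤ m → ((Fin.ofNat (m + 1) k : Fin (m + 1)) : ℕ) = k := fun hk => by
    simp [Fin.ofNat, Nat.mod_eq_of_lt (Nat.lt_succ_of_le hk)]
  induction q generalizing v S with
  | push k f q ih =>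
    simp only [bound, max_le_iff] at hq
    simp only [restrict, TM2.stepAux]
    rw [update_restrict hq.1, ih hq.2, h0 hq.1]
  | peek k f q ih =>
    simp only [bound, max_le_iff] at hq
    simp only [restrict, TM2.stepAux]
    rw [ih hq.2, h0 hq.1]
  | pop k f q ih =>
    simp only [bound, max_le_iff] at hq
    simp only [restrict, TM2.stepAux]
    rw [update_restrict hq.1, ih hq.2, h0 hq.1]
  | load f q ih => exact ih hq _ _
  | branch f q₁ q₂ ih₁ ih₂ =>
    simp only [bound, max_le_iff] at hq
    simp only [restrict, TM2.stepAux]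
    cases f v
    exacts [ih₂ hq.2 _ _, ih₁ hq.1 _ _]
  | goto f => rfl
  | halt => rfl

theorem step_restrict {Λ : Type} {m : ℕ} {M : Λ → Stmt Λ} (hM : ∀ l, bound (M l) ≤ m)
    (c : Cfg Λ) : TM2.step (fun l => restrict m (M l)) (restrictCfg m c) =
      (TM2.step M c).map (restrictCfg m) := by
  obtain ⟨l, v, S⟩ := c
  cases l with
  | none => rfl
  | some l => exact congrArg some (stepAux_restrict _ (hM l) v S)

theorem ReachesIn.restrict {Λ : Type} {m : ℕ} {M : Λ → Stmt Λ} (hM : ∀ l, bound (M l) ≤ m)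
    {t : ℕ} {c d : Cfg Λ} (h : ReachesIn (TM2.step M) t c d) :
    ReachesIn (TM2.step fun l => StackProgram.restrict m (M l)) t (restrictCfg m c)
      (restrictCfg m d) := by
  obtain ⟨n, hn, h⟩ := h
  refine ⟨n, hn, ?_⟩
  have key : ∀ o : Option (Cfg Λ),
      (flip bind (TM2.step fun l => StackProgram.restrict m (M l)))^[n] (o.map (restrictCfg m)) =
        ((flip bind (TM2.step M))^[n] o).map (restrictCfg m) := by
    intro o
    refine (Semiconj.iterate_right (f := Option.map (restrictCfg m)) ?_ n o).symm
    rintro (_ | c)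
    · rfl
    · exact (step_restrict hM c).symm
  have := key (some c)
  rw [h] at this
  exact this

/-- The program that consists of a block and a final reset of the internal state. -/
def Block.program (B : Block) : B.Lab ⊕ Unit → Stmt (B.Lab ⊕ Unit)
  | .inl l => B.code _ .inl (.inr ()) l
  | .inr _ => TM2.Stmt.load (fun _ => none) TM2.Stmt.halt

def Block.machine (B : Block) (m : ℕ) : FinTM2 where
  K := Fin (m + 1)
  k₀ := 0
  k₁ := 0
  Γ _ := Γ'
  Λ := B.Lab ⊕ Unit
  main := .inl B.entry
  ΛFin := @instFintypeSum _ _ B.fin _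
  σ := Option Γ'
  initialState := none
  Γk₀Fin := inferInstanceAs (Fintype Γ')
  m l := restrict m (B.program l)

/-- The stacks that are empty except for the first one. -/
def single (w : List Γ') : Stacks := fun i => if i = 0 then w else []

theorem initList_machine (B : Block) (m : ℕ) (w : List Γ') :
    initList (B.machine m) w = restrictCfg m ⟨some (.inl B.entry), none, single w⟩ := by
  refine congrArg (TM2.Cfg.mk _ _) (funext fun k => ?_)
  by_cases hk : k = (0 : Fin (m + 1))
  · subst hk
    rfl
  · exact (dif_neg hk).trans (if_neg (fun h => hk (Fin.ext h))).symm

theorem haltList_machine (B : Block) (m : ℕ) (w : List Γ') :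
    haltList (B.machine m) w = restrictCfg m ⟨none, none, single w⟩ := by
  refine congrArg (TM2.Cfg.mk _ _) (funext fun k => ?_)
  by_cases hk : k = (0 : Fin (m + 1))
  · subst hk
    rfl
  · exact (dif_neg hk).trans (if_neg (fun h => hk (Fin.ext h))).symm

/-- The program writes the output in reverse on stack 2; the input is then cleared and the output
moved to stack 0, which reverses it again. A program has finitely many labels and so mentions
finitely many stacks, which allows the passage to a finite machine. -/
theorem Emits.computable {α β : Type} {ea : α → List Γ'} {eb : β → List Γ'} {f : α → β}
    (h : Emits (fun a => single (ea a)) fun a => eb (f a)) :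
    Nonempty (TM2ComputableInPolyTime ea eb f) := by
  obtain ⟨P, hP, h⟩ := h
  -- Input 0 is on stack 0; all other inputs are empty words and share stack 1, which is never
  -- written to. Scratch space starts at stack 3.
  obtain ⟨B, hB⟩ := h (fun i => if i = 0 then 0 else 1) 2 3 (by intro i; split_ifs <;> omega)
    (by omega) (by intro i; split_ifs <;> omega)
  let C : Block := B.seq ((Block.move 0 []).seq (Block.move 2 [0]))
  let _ : Fintype C.Lab := C.fin
  let m : ℕ := Finset.univ.sup fun l => bound (C.program l)
  have hm : ∀ l, bound (C.program l) ≤ m := fun l =>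
    Finset.le_sup (f := fun l => bound (C.program l)) (Finset.mem_univ l)
  have run : ∀ a, C.Runs (single (ea a)) (single (eb (f a)))
      (P.eval (ea a).length + (2 * (ea a).length + 1 + (3 * P.eval (ea a).length + 1))) := by
    intro a
    have hl : ∀ i, (single (ea a) i).length ≤ (ea a).length := by
      intro i; simp only [single]; split_ifs <;> simp
    have r1 := hB a (single (ea a)) _ (by intro i; by_cases hi : i = 0 <;> simp [single, hi])
      (by intro r hr; simp only [single]; rw [if_neg (by omega)]) hl
    rw [show single (ea a) 2 = [] from rfl, List.append_nil] at r1
    have r2 := Block.runs_clear 0 (update (single (ea a)) 2 (eb (f a)).reverse)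
    have r3 := Block.runs_move (r := 2) (r₁ := 0) (by omega)
      (update (update (single (ea a)) 2 (eb (f a)).reverse) 0 [])
    have e : update (update (update (update (single (ea a)) 2 (eb (f a)).reverse) 0 []) 2 []) 0
        (eb (f a)) = single (eb (f a)) := by
      funext k
      by_cases h0 : k = 0
      · subst h0; simp [single]
      · by_cases h2 : k = 2
        · subst h2; simp [single]
        · simp [single, h0, h2]
    rw [update_of_ne (by omega : 0 ≠ 2)] at r2
    rw [update_of_ne (by omega : 2 ≠ 0), update_self, update_self, List.append_nil,
      List.reverse_reverse, e, List.length_reverse] at r3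
    refine Block.Runs.mono (r1.seq (r2.seq r3)) ?_
    have : (eb (f a)).length ≤ P.eval (ea a).length := hP a _ hl
    simp only [single, if_true]
    omega
  -- The last summand 1 is the step that resets the internal state and halts.
  refine ⟨⟨⟨C.machine m, Equiv.refl _, Equiv.refl _⟩,
    P + (2 * Polynomial.X + 1 + (3 * P + 1)) + 1, fun a => ?_⟩⟩
  have hr : ReachesIn (TM2.step C.program) _ _ _ :=
    ((run a _ C.program .inl (.inr ()) (fun _ => rfl) none).choose_spec).trans (.step rfl)
  have hr := hr.restrict hm
  refine Classical.choice ?_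
  obtain ⟨n, hn, hr⟩ := hr
  refine ⟨⟨⟨n, ?_⟩, hn.trans (le_of_eq ?_)⟩⟩
  · simp only [Option.map_some]
    erw [List.map_id, List.map_id]
    rw [initList_machine, haltList_machine]
    exact hr
  · simp

end StackProgram

namespace StackProgram

/-! ### Derived constructions -/

/-- The output of a finite automaton that writes `out q c` when it reads `c` in state `q`. -/
def transduce {Q : Type} (δ : Q → Γ' → Q) (out : Q → Γ' → List Γ') : Q → List Γ' → List Γ'
  | _, [] => []
  | q, c :: s => out q c ++ transduce δ out (δ q c) s

/-- The word that represents a number in unary. -/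
def un (n : ℕ) : List Γ' := List.replicate n Γ'.blank

theorem un_add (m n : ℕ) : un (m + n) = un m ++ un n := List.replicate_add _ _ _

/-- `π'` provides all words that `π` provides. -/
def Extends {A A' : Type} (π' : A' → ℕ → List Γ') (π : A → ℕ → List Γ') (k : A' → A) : Prop :=
  ∃ f : ℕ → ℕ, ∀ x i, π (k x) i = π' x (f i)

theorem Extends.refl {A : Type} (π : A → ℕ → List Γ') : Extends π π id := ⟨id, fun _ _ => rfl⟩

namespace Emits

variable {A : Type} {π : A → ℕ → List Γ'} {g : A → List Γ'}

theorem lift {A' : Type} {π' : A' → ℕ → List Γ'} {k : A' → A} (hg : Emits π g)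
    (e : Extends π' π k) : Emits π' fun x => g (k x) :=
  let ⟨f, hf⟩ := e
  hg.comap k f hf

theorem transduce_reg {Q : Type} [Fintype Q] (i : ℕ) (δ : Q → Γ' → Q) (out : Q → Γ' → List Γ')
    (q₀ : Q) : Emits π fun a => transduce δ out q₀ (π a i) := by
  refine (Emits.scan i δ q₀ (o := fun _ q c _ _ => out q c) (fun _ _ _ _ => True) (fun _ => trivial)
    (fun _ _ _ _ _ _ => trivial) fun q c => const _).congr fun a => ?_
  have : ∀ s p q, scanOut δ (fun q c _ _ => out q c) q p s = transduce δ out q s := by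
    intro s
    induction s with
    | nil => exact fun _ _ => rfl
    | cons c s ih => exact fun p q => congrArg (out q c ++ ·) (ih _ _)
  exact this _ _ _

theorem transduce {Q : Type} [Fintype Q] (δ : Q → Γ' → Q) (out : Q → Γ' → List Γ')
    (q₀ : Q) (hg : Emits π g) : Emits π fun a => StackProgram.transduce δ out q₀ (g a) :=
  hg.bind (transduce_reg 0 δ out q₀)

theorem flatMap (f : Γ' → List Γ') (hg : Emits π g) : Emits π fun a => (g a).flatMap f :=
  (hg.transduce (Q := Unit) (fun _ _ => ()) (fun _ c => f c) ()).congr fun a => by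
    induction g a with
    | nil => rfl
    | cons c s ih => rw [StackProgram.transduce, ih, List.flatMap_cons]

theorem reg {w : A → List Γ'} (i : ℕ) (h : ∀ a, π a i = w a) : Emits π w :=
  (transduce_reg i (Q := Unit) (fun _ _ => ()) (fun _ c => [c]) ()).congr fun a => by
    rw [← h a]
    induction π a i with
    | nil => rfl
    | cons c s ih => rw [StackProgram.transduce, ih]; rfl

/-- A scan of a unary word: the part already read is the index in unary and the unread part is the
number of remaining rounds, so differences come without a subtraction program. The body is required
for every environment that extends the given one, which frees its author from the positions of the
inputs. -/
theorem forRange {m : A → ℕ} {o : A → ℕ → List Γ'} (hm : Emits π fun a => un (m a))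
    (body : ∀ (A' : Type) (π' : A' → ℕ → List Γ') (k : A' → A) (j : A' → ℕ), Extends π' π k →
      Emits π' (fun x => un (j x)) → Emits π' (fun x => un (m (k x) - 1 - j x)) →
      Emits π' fun x => o (k x) (j x)) :
    Emits π fun a => (List.range (m a)).flatMap (o a) := by
  refine hm.bind ((Emits.scan 0 (Q := Unit) (fun _ _ => ()) () (o := fun a _ _ p _ => o a p.length)
    (fun a _ p s => p = un p.length ∧ s = un s.length ∧ p.length + s.length = m a)
    (fun a => by simp [cons, un]) ?_ fun _ c => ?_).congr fun a => ?_)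
  · rintro a - p c s ⟨h1, h2, h3⟩
    simp only [un, List.length_cons, List.replicate_succ, List.cons.injEq] at h2 ⊢
    exact ⟨⟨h2.1, h1⟩, h2.2, by simp only [List.length_cons] at h3; omega⟩
  · let X := {x : A × List Γ' × List Γ' // x.2.1 = un x.2.1.length ∧
      c :: x.2.2 = un (c :: x.2.2).length ∧ x.2.1.length + (c :: x.2.2).length = m x.1}
    -- Three words precede the original inputs: the unread part, the read part and the unary word
    -- that is scanned.
    refine body X _ (fun x => x.1.1) (fun x => x.1.2.1.length) ⟨fun i => i + 3, fun _ _ => rfl⟩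
      (reg 1 fun x => x.2.1) (reg 0 fun x : X => ?_)
    obtain ⟨⟨a, p, s⟩, h1, h2, h3⟩ := x
    simp only [un, List.length_cons, List.replicate_succ, List.cons.injEq] at h2 h3 ⊢
    refine h2.2.trans ?_
    congr 1
    omega
  · have : ∀ s p, scanOut (fun (_ : Unit) _ => ()) (fun _ _ p _ => o a p.length) () p s =
        (List.range' p.length s.length).flatMap (o a) := by
      intro s
      induction s with
      | nil => exact fun _ => rfl
      | cons c s ih =>
        intro p
        rw [scanOut, ih, List.length_cons (as := s), List.range'_succ, List.flatMap_cons,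
          List.length_cons]
    rw [this, List.range_eq_range']
    simp [cons, un]

/-! ### Loops over lists of encoded records -/

/-- A finite automaton that reads `s` from the state `q` ends in `q₀`, where it was not before. -/
def Returns {Q : Type} (δ : Q → Γ' → Q) (q₀ : Q) : Q → List Γ' → Prop
  | q, [] => q = q₀
  | q, c :: s => q ≠ q₀ ∧ Returns δ q₀ (δ q c) s

open Classical in
/-- A loop over a list of records, the boundaries of which are found by a finite automaton. -/
theorem forRecords {Q α : Type} [Fintype Q] {e : α → List Γ'} (he : Enc.Readable e)
    (δ : Q → Γ' → Q) (q₀ : Q) (hδ : ∀ x, ∃ c s, e x = c :: s ∧ Returns δ q₀ (δ q₀ c) s)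
    {l : A → List α} {o : A → α → List Γ'} (hl : Emits π fun a => (l a).flatMap e)
    (body : Emits (A := A × α × List Γ') (fun x => cons (e x.2.1 ++ x.2.2) (π x.1))
      fun x => o x.1 x.2.1) : Emits π fun a => (l a).flatMap (o a) := by
  -- Output is produced only at the start of a record. The record is chosen from the word to be
  -- read; unique readability makes the choice the intended one.
  let out (a : A) (q : Q) (c : Γ') (_ s : List Γ') : List Γ' :=
    if h : q = q₀ ∧ ∃ x u, c :: s = e x ++ u then o a h.2.choose else []
  refine hl.bind ((Emits.scan 0 δ q₀ (o := out)
    (fun _ q _ s => ∃ (s₁ : List Γ') (l' : List α), s = s₁ ++ l'.flatMap e ∧ Returns δ q₀ q s₁)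
    (fun a => ⟨[], l a, rfl, rfl⟩) ?_ fun q c => ?_).congr fun a => ?_)
  · rintro a q p c s ⟨s₁, l', hs, hr⟩
    cases s₁ with
    | cons d s₁ =>
      obtain ⟨rfl, rfl⟩ := List.cons.inj hs
      exact ⟨s₁, l', rfl, hr.2⟩
    | nil =>
      obtain rfl : q = q₀ := hr
      cases l' with
      | nil => cases hs
      | cons x l' =>
        obtain ⟨d, s', h1, h2⟩ := hδ x
        rw [List.nil_append, List.flatMap_cons, h1] at hs
        obtain ⟨rfl, rfl⟩ := List.cons.inj hs
        exact ⟨s', l', rfl, h2⟩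
  · by_cases hq : q = q₀
    · subst hq
      have hex : ∀ x : {x : A × List Γ' × List Γ' // ∃ (s₁ : List Γ') (l' : List α),
          c :: x.2.2 = s₁ ++ l'.flatMap e ∧ Returns δ q q s₁}, ∃ y u, c :: x.1.2.2 = e y ++ u := by
        rintro ⟨⟨a, p, s⟩, s₁, l', hs, hr⟩
        cases s₁ with
        | cons d s₁ => exact (hr.1 rfl).elim
        | nil =>
          cases l' with
          | nil => cases hs
          | cons y l' => exact ⟨y, l'.flatMap e, hs⟩
      -- The scan has already removed the first symbol of the record, so it is put back in front of
      -- the rest.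
      refine (Emits.bind ((symbol c).append (reg 0 fun _ => rfl)) (body.comap
        (fun x : {x : A × List Γ' × List Γ' // ∃ (s₁ : List Γ') (l' : List α),
          c :: x.2.2 = s₁ ++ l'.flatMap e ∧ Returns δ q q s₁} =>
          (x.1.1, (hex x).choose, (hex x).choose_spec.choose))
        (fun | 0 => 0 | i + 1 => i + 4) ?_)).congr fun x => ?_
      · rintro x (_ | i)
        · exact (hex x).choose_spec.choose_spec.symm
        · rfl
      · simp only [out]
        rw [dif_pos ⟨trivial, hex x⟩]
    · refine nil.congr fun x => ?_
      simp only [out]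
      rw [dif_neg fun h => hq h.1]
  -- Inside a record the automaton is away from `q₀`, and nothing is written until the next record
  -- begins.
  · have skip : ∀ s q p u, Returns δ q₀ q s →
        ∃ p', scanOut δ (out a) q p (s ++ u) = scanOut δ (out a) q₀ p' u := by
      intro s
      induction s with
      | nil => rintro q p u rfl; exact ⟨p, rfl⟩
      | cons c s ih =>
        rintro q p u ⟨h1, h2⟩
        obtain ⟨p', hp⟩ := ih _ (c :: p) u h2
        refine ⟨p', ?_⟩
        rw [List.cons_append, scanOut, hp]
        simp only [out]
        rw [dif_neg fun h => h1 h.1, List.nil_append]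
    have main : ∀ (l' : List α) p, scanOut δ (out a) q₀ p (l'.flatMap e) = l'.flatMap (o a) := by
      intro l'
      induction l' with
      | nil => exact fun _ => rfl
      | cons x l' ih =>
        intro p
        obtain ⟨c, s, h1, h2⟩ := hδ x
        obtain ⟨p', hp⟩ := skip s _ (c :: p) (l'.flatMap e) h2
        have hx : ∃ y u, c :: (s ++ l'.flatMap e) = e y ++ u := ⟨x, l'.flatMap e, by rw [h1]; rfl⟩
        have hy : hx.choose = x :=
          (he.1 hx.choose x hx.choose_spec.choose (l'.flatMap e)
            (by rw [← hx.choose_spec.choose_spec, h1]; rfl)).1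
        rw [List.flatMap_cons, List.flatMap_cons, h1, List.cons_append, scanOut, hp, ih]
        simp only [out]
        rw [dif_pos ⟨trivial, hx⟩, hy]
    exact main _ _

theorem returns_bits {Q : Type} {δ : Q → Γ' → Q} {q₀ q : Q} (hq : q ≠ q₀)
    (hδ : ∀ b, δ q (Γ'.bit b) = q) (w : List Bool) {s : List Γ'}
    (h : Returns δ q₀ (δ q Γ'.comma) s) : Returns δ q₀ q (w.map Γ'.bit ++ Γ'.comma :: s) := by
  induction w with
  | nil => exact ⟨hq, h⟩
  | cons b w ih => exact ⟨hq, by rwa [hδ]⟩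

/-- The part of a word before the first occurrence of a symbol. -/
theorem before {w u : A → List Γ'} (c : Γ') (hw : ∀ a, c ∉ w a)
    (hg : Emits π fun a => w a ++ c :: u a) : Emits π w := by
  refine (hg.transduce (fun q d => q || d == c) (fun q d => if q || d == c then [] else [d])
    false).congr fun a => ?_
  have h1 : ∀ u : List Γ', StackProgram.transduce (fun q d => q || d == c)
      (fun q d => if q || d == c then [] else [d]) true u = [] := by
    intro u
    induction u with
    | nil => rfl
    | cons c u ih => simpa [StackProgram.transduce] using ih
  have h2 := hw a
  generalize w a = w at h2 ⊢
  induction w with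
  | nil =>
    simp only [List.nil_append, StackProgram.transduce, Bool.false_or, beq_self_eq_true, ↓reduceIte]
    exact h1 _
  | cons d w ih =>
    simp only [List.mem_cons, not_or] at h2
    have hd : (d == c) = false := by simpa using Ne.symm h2.1
    simp only [List.cons_append, StackProgram.transduce, Bool.false_or, hd, Bool.false_eq_true,
      ↓reduceIte, List.nil_append, ih h2.2]

/-- The part of a word after the first occurrence of a symbol. -/
theorem after {w u : A → List Γ'} (c : Γ') (hw : ∀ a, c ∉ w a)
    (hg : Emits π fun a => w a ++ c :: u a) : Emits π u := by
  refine (hg.transduce (fun q d => q || d == c) (fun q d => if q then [d] else []) false).congr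
    fun a => ?_
  have h1 : ∀ u : List Γ', StackProgram.transduce (fun q d => q || d == c)
      (fun q d => if q then [d] else []) true u = u := by
    intro u
    induction u with
    | nil => rfl
    | cons c u ih => simpa [StackProgram.transduce] using ih
  have h2 := hw a
  generalize w a = w at h2 ⊢
  induction w with
  | nil =>
    simp only [List.nil_append, StackProgram.transduce, Bool.false_or, beq_self_eq_true, ↓reduceIte,
      Bool.false_eq_true]
    exact h1 _
  | cons d w ih =>
    simp only [List.mem_cons, not_or] at h2
    have hd : (d == c) = false := by simpa using Ne.symm h2.1
    simp only [List.cons_append, StackProgram.transduce, Bool.false_or, hd, Bool.false_eq_true,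
      ↓reduceIte, List.nil_append, ih h2.2]

theorem firstToken {x : A → ℕ} {u : A → List Γ'} (hg : Emits π fun a => Enc.nat (x a) ++ u a) :
    Emits π fun a => Enc.nat (x a) :=
  (before (w := fun a => (encodeNat (x a)).map Γ'.bit) (u := u) Γ'.comma (fun a => by simp)
    (hg.congr fun a => by simp [Enc.nat])).append (.const _)

theorem dropToken {x : A → ℕ} {u : A → List Γ'} (hg : Emits π fun a => Enc.nat (x a) ++ u a) :
    Emits π u :=
  after (w := fun a => (encodeNat (x a)).map Γ'.bit) (u := u) Γ'.comma (fun a => by simp)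
    (hg.congr fun a => by simp [Enc.nat])

theorem entries {α : Type} {e : α → List Γ'} {l : A → List α} {u : A → List Γ'}
    (he : ∀ x, Γ'.ket ∉ e x) (hg : Emits π fun a => Enc.list e (l a) ++ u a) :
    Emits π (fun a => (l a).flatMap e) ∧ Emits π u := by
  have h1 : Emits π fun a => (l a).flatMap e ++ Γ'.ket :: u a :=
    after (w := fun _ => []) Γ'.bra (fun a => by simp) (hg.congr fun a => by simp [Enc.list])
  have h2 : ∀ a, Γ'.ket ∉ (l a).flatMap e := fun a => by simpa using fun x _ => he x
  exact ⟨before _ h2 h1, after _ h2 h1⟩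

theorem forNats {l : A → List ℕ} {o : A → ℕ → List Γ'} (hl : Emits π fun a => (l a).flatMap Enc.nat)
    (body : ∀ (A' : Type) (π' : A' → ℕ → List Γ') (k : A' → A) (x : A' → ℕ), Extends π' π k →
      Emits π' (fun y => Enc.nat (x y)) → Emits π' fun y => o (k y) (x y)) :
    Emits π fun a => (l a).flatMap (o a) := by
  refine forRecords Enc.readable_nat (fun _ c => c == Γ'.comma) true (fun x => ?_) hl
    (body (A × ℕ × List Γ') _ Prod.fst (fun y => y.2.1) ⟨Nat.succ, fun _ _ => rfl⟩
      (firstToken (u := fun y => y.2.2) (reg 0 fun y => rfl)))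
  rw [Enc.nat]
  cases encodeNat x with
  | nil => exact ⟨_, _, rfl, rfl⟩
  | cons b w => exact ⟨_, _, rfl, returns_bits (q := false) (by decide) (fun _ => rfl) w rfl⟩

/-- States 0 and 1 both read the first number. State 0 marks only the start of a triple, as the
automaton must not be there again before the triple ends. -/
def transAutomaton : Fin 4 → Γ' → Fin 4
  | 0, Γ'.comma => 2
  | 0, _ => 1
  | 1, Γ'.comma => 2
  | 1, _ => 1
  | 2, Γ'.comma => 3
  | 2, _ => 2
  | 3, Γ'.comma => 0
  | 3, _ => 3

theorem forTrans {l : A → List (ℕ × ℕ × ℕ)} {o : A → ℕ × ℕ × ℕ → List Γ'}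
    (hl : Emits π fun a => (l a).flatMap Enc.trans)
    (body : ∀ (A' : Type) (π' : A' → ℕ → List Γ') (k : A' → A) (x : A' → ℕ × ℕ × ℕ),
      Extends π' π k → Emits π' (fun y => Enc.nat (x y).1) → Emits π' (fun y => Enc.nat (x y).2.1) →
      Emits π' (fun y => Enc.nat (x y).2.2) → Emits π' fun y => o (k y) (x y)) :
    Emits π fun a => (l a).flatMap (o a) := by
  have h1 : Emits (fun y : A × (ℕ × ℕ × ℕ) × List Γ' => cons (Enc.trans y.2.1 ++ y.2.2) (π y.1))
      fun y => Enc.nat y.2.1.1 ++ (Enc.nat y.2.1.2.1 ++ (Enc.nat y.2.1.2.2 ++ y.2.2)) :=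
    reg 0 fun y => by simp [cons, Enc.trans]
  have h2 := Emits.dropToken (x := fun y : A × (ℕ × ℕ × ℕ) × List Γ' => y.2.1.1) h1
  have h3 := Emits.dropToken (x := fun y : A × (ℕ × ℕ × ℕ) × List Γ' => y.2.1.2.1) h2
  refine forRecords Enc.readable_trans transAutomaton 0 (fun x => ?_) hl
    (body (A × (ℕ × ℕ × ℕ) × List Γ') _ Prod.fst (fun y => y.2.1) ⟨Nat.succ, fun _ _ => rfl⟩
      (Emits.firstToken (x := fun y : A × (ℕ × ℕ × ℕ) × List Γ' => y.2.1.1) h1)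
      (Emits.firstToken (x := fun y : A × (ℕ × ℕ × ℕ) × List Γ' => y.2.1.2.1) h2)
      (Emits.firstToken (x := fun y : A × (ℕ × ℕ × ℕ) × List Γ' => y.2.1.2.2) h3))
  have h4 : Returns transAutomaton 0 3 (Enc.nat x.2.2) :=
    returns_bits (by decide) (fun _ => rfl) _ (s := []) rfl
  have h5 : Returns transAutomaton 0 2 (Enc.nat x.2.1 ++ Enc.nat x.2.2) := by
    rw [Enc.nat, List.append_assoc, List.singleton_append]
    exact returns_bits (by decide) (fun _ => rfl) _ h4
  rw [Enc.trans, List.append_assoc, Enc.nat, List.append_assoc, List.singleton_append]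
  cases encodeNat x.1 with
  | nil => exact ⟨_, _, rfl, h5⟩
  | cons b w => exact ⟨_, _, rfl, returns_bits (q := 1) (by decide) (fun _ => rfl) w h5⟩

end Emits

end StackProgram

namespace HitOrRunGame

open HitOrRunGame.Sym StackProgram

/-! ### The names of the symbols -/

def bitsToPosNum : List Bool → PosNum
  | [] => PosNum.one
  | false :: w => PosNum.bit0 (bitsToPosNum w)
  | true :: w => PosNum.bit1 (bitsToPosNum w)

theorem encodePosNum_bitsToPosNum (w : List Bool) :
    encodePosNum (bitsToPosNum w) = w ++ [true] := by
  induction w with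
  | nil => rfl
  | cons b w ih => cases b <;> simp [bitsToPosNum, encodePosNum, ih]

theorem encodeNat_bitsToPosNum (w : List Bool) :
    encodeNat (bitsToPosNum w : ℕ) = w ++ [true] := by
  rw [encodeNat, PosNum.of_to_nat, encodeNum, encodePosNum_bitsToPosNum]

/-- A code of the symbols of the alphabet by three bits. -/
def code : Γ' → List Bool
  | Γ'.blank => [false, false, false]
  | Γ'.bit b => [true, false, b]
  | Γ'.bra => [false, true, false]
  | Γ'.ket => [false, true, true]
  | Γ'.comma => [false, false, true]

theorem flatMap_code_injective : Function.Injective fun w : List Γ' => w.flatMap code := by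
  intro v
  induction v with
  | nil =>
    intro w h
    cases w with
    | nil => rfl
    | cons d w => cases d <;> simp [code] at h
  | cons c v ih =>
    intro w h
    cases w with
    | nil => cases c <;> simp [code] at h
    | cons d w =>
      have : c = d ∧ v.flatMap code = w.flatMap code := by
        cases c <;> cases d <;> simp_all [code]
      rw [this.1, ih this.2]

/-- The word that describes a symbol. -/
def Sym.word : Sym → List Γ'
  | bit j b => [Γ'.bra, Γ'.bit b] ++ un j
  | bounded => [Γ'.bra, Γ'.ket]
  | bot => [Γ'.bra, Γ'.bra]
  | guard => [Γ'.bra, Γ'.comma]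
  | weight l => [Γ'.bra, Γ'.blank] ++ Enc.nat l
  | win s => [Γ'.ket, Γ'.bra] ++ Enc.nat s
  | any s => [Γ'.ket, Γ'.ket] ++ Enc.nat s
  | every s => [Γ'.ket, Γ'.comma] ++ Enc.nat s
  | move l t => [Γ'.ket, Γ'.blank] ++ Enc.nat l ++ Enc.nat t

theorem Sym.word_injective : Function.Injective Sym.word := by
  have hnat : ∀ {m n}, Enc.nat m = Enc.nat n → m = n := fun {m n} h =>
    (Enc.readable_nat.1 m n [] [] (by simpa using h)).1
  intro v w h
  cases v <;> cases w <;>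
    simp only [Sym.word, List.cons_append, List.nil_append, List.cons.injEq, Γ'.bit.injEq,
      reduceCtorEq, false_and, and_false, true_and] at h
  case bit.bit => simp_all [un]
  case win.win => rw [hnat h]
  case any.any => rw [hnat h]
  case every.every => rw [hnat h]
  case weight.weight => rw [hnat h]
  case move.move =>
    obtain ⟨h1, h2⟩ := Enc.readable_nat.1 _ _ _ _ h
    rw [h1, hnat h2]
  all_goals rfl

/-- The name of a symbol. -/
def Sym.name (v : Sym) : ℕ := bitsToPosNum (v.word.flatMap code)

theorem Sym.name_injective : Function.Injective Sym.name := by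
  intro v w h
  have := congrArg encodeNat h
  rw [Sym.name, Sym.name, encodeNat_bitsToPosNum, encodeNat_bitsToPosNum] at this
  exact Sym.word_injective (flatMap_code_injective (List.append_left_injective _ this))

/-- The code of a name arises from the word of the symbol by a letterwise substitution and a fixed
ending, so a finite automaton can write it without arithmetic on names. -/
theorem Sym.nat_name (v : Sym) : Enc.nat v.name =
    (v.word.flatMap fun c => (code c).map Γ'.bit) ++ [Γ'.bit true, Γ'.comma] := by
  rw [Sym.name, Enc.nat, encodeNat_bitsToPosNum, List.map_append, List.map_flatMap,
    List.append_assoc]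
  rfl

/-! ### Programs that write rules -/

/-- The three lists that describe a system. -/
inductive Part
  | vars
  | acts
  | rules

/-- The contribution of a rule to a part of the description of a system. -/
def SymRule.write (r : SymRule) : Part → List Γ'
  | .vars => (r.lhs :: r.rhs).flatMap fun v => Enc.nat v.name
  | .acts => Enc.action (actName Sym.name r.act)
  | .rules => Enc.rule (r.toRule Sym.name)

variable {A : Type} {π : A → ℕ → List Γ'}

def EmitsSym (π : A → ℕ → List Γ') (v : A → Sym) : Prop := Emits π fun a => (v a).word

def EmitsWord (π : A → ℕ → List Γ') (w : A → List Sym) : Prop :=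
  Emits π fun a => (w a).flatMap fun v => Enc.nat v.name

def EmitsRules (π : A → ℕ → List Γ') (rs : A → List SymRule) : Prop :=
  ∀ p, Emits π fun a => (rs a).flatMap fun r => r.write p

section EmitsSym

variable {A' : Type} {π' : A' → ℕ → List Γ'} {k : A' → A}

theorem EmitsSym.lift {v : A → Sym} (h : EmitsSym π v) (e : Extends π' π k) :
    EmitsSym π' fun x => v (k x) :=
  Emits.lift (g := fun a => (v a).word) h e

theorem EmitsWord.lift {w : A → List Sym} (h : EmitsWord π w) (e : Extends π' π k) :
    EmitsWord π' fun x => w (k x) := by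
  unfold EmitsWord at h ⊢
  generalize (fun v => Enc.nat (Sym.name v)) = f at h ⊢
  exact Emits.lift (k := k) (g := fun a => (w a).flatMap f) h e

theorem EmitsSym.nat {v : A → Sym} (h : EmitsSym π v) : Emits π fun a => Enc.nat (v a).name :=
  ((Emits.flatMap _ h).append (.const _)).congr fun _ => (Sym.nat_name _).symm

theorem emitsSym_const (v : Sym) : EmitsSym π fun _ => v := Emits.const _

theorem emitsSym_bit {j : A → ℕ} (b : Bool) (h : Emits π fun a => un (j a)) :
    EmitsSym π fun a => bit (j a) b :=
  (Emits.const _).append h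

theorem emitsSym_weight {l : A → ℕ} (h : Emits π fun a => Enc.nat (l a)) :
    EmitsSym π fun a => weight (l a) :=
  (Emits.const _).append h

theorem emitsSym_win {s : A → ℕ} (h : Emits π fun a => Enc.nat (s a)) :
    EmitsSym π fun a => win (s a) :=
  (Emits.const _).append h

theorem emitsSym_any {s : A → ℕ} (h : Emits π fun a => Enc.nat (s a)) :
    EmitsSym π fun a => any (s a) :=
  (Emits.const _).append h

theorem emitsSym_every {s : A → ℕ} (h : Emits π fun a => Enc.nat (s a)) :
    EmitsSym π fun a => every (s a) :=
  (Emits.const _).append h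

theorem emitsSym_move {l t : A → ℕ} (hl : Emits π fun a => Enc.nat (l a))
    (ht : Emits π fun a => Enc.nat (t a)) : EmitsSym π fun a => move (l a) (t a) :=
  ((Emits.const _).append hl).append ht

theorem encodeNat_two_pow (k : ℕ) : encodeNat (2 ^ k) = List.replicate k false ++ [true] := by
  have h : ((bitsToPosNum (List.replicate k false) : PosNum) : ℕ) = 2 ^ k := by
    induction k with
    | zero => rfl
    | succ k ih => rw [List.replicate_succ, bitsToPosNum, PosNum.cast_bit0, ih, pow_succ]; omega
  rw [← h, encodeNat_bitsToPosNum]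

/-- The least significant digit comes first, so a unary exponent becomes the binary code of the
power by turning each mark into a zero and appending a one. -/
theorem emitsSym_weight_two_pow {j : A → ℕ} (h : Emits π fun a => un (j a)) :
    EmitsSym π fun a => weight (2 ^ j a) :=
  emitsSym_weight (((h.flatMap fun _ => [Γ'.bit false]).append
    (.const [Γ'.bit true, Γ'.comma])).congr fun a => by
      simp only [Enc.nat, encodeNat_two_pow, un, List.map_append, List.map_replicate,
        List.append_assoc]
      congr 1
      induction j a with
      | zero => rfl
      | succ n ih => rw [List.replicate_succ, List.flatMap_cons, ih]; rfl)

theorem emitsWord_nil : EmitsWord π fun _ => [] := Emits.nil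

theorem EmitsSym.cons {v : A → Sym} {w : A → List Sym} (hv : EmitsSym π v) (hw : EmitsWord π w) :
    EmitsWord π fun a => v a :: w a :=
  hv.nat.append hw

theorem EmitsWord.append {v w : A → List Sym} (hv : EmitsWord π v) (hw : EmitsWord π w) :
    EmitsWord π fun a => v a ++ w a :=
  (Emits.append hv hw).congr fun a => by rw [List.flatMap_append]

theorem EmitsWord.map_range {m : A → ℕ} {v : A → ℕ → Sym} (hm : Emits π fun a => un (m a))
    (h : ∀ (A' : Type) (π' : A' → ℕ → List Γ') (k : A' → A) (j : A' → ℕ), Extends π' π k →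
      Emits π' (fun x => un (j x)) → EmitsSym π' fun x => v (k x) (j x)) :
    EmitsWord π fun a => (List.range (m a)).map (v a) :=
  (Emits.forRange hm (o := fun a j => Enc.nat (v a j).name) fun A' π' k j e hj _ =>
    (h A' π' k j e hj).nat).congr fun a => by rw [List.flatMap_map]

end EmitsSym

section EmitsRules

theorem emitsRules_nil : EmitsRules π fun _ => [] := fun _ => Emits.nil

theorem EmitsRules.append {r s : A → List SymRule} (hr : EmitsRules π r) (hs : EmitsRules π s) :
    EmitsRules π fun a => r a ++ s a := fun p =>
  ((hr p).append (hs p)).congr fun a => by rw [List.flatMap_append]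

def EmitsRule (π : A → ℕ → List Γ') (r : A → SymRule) : Prop := ∀ p, Emits π fun a => (r a).write p

theorem EmitsRule.cons {r : A → SymRule} {s : A → List SymRule} (hr : EmitsRule π r)
    (hs : EmitsRules π s) : EmitsRules π fun a => r a :: s a := fun p =>
  (hr p).append (hs p)

theorem emitsRule {v : A → Sym} {o : A → Option Sym} {w : A → List Sym} (hv : EmitsSym π v)
    (ho : Emits π fun a => Enc.action (actName Sym.name (o a))) (hw : EmitsWord π w) :
    EmitsRule π fun a => ⟨v a, o a, w a⟩
  | .vars => hv.nat.append hw
  | .acts => ho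
  | .rules => ((hv.nat.append ho).append (((Emits.const [Γ'.bra]).append hw).append
      (.const [Γ'.ket]))).congr fun a => by
        simp [SymRule.write, SymRule.toRule, Enc.rule, Enc.list, List.flatMap_map]

theorem emitsRule_visible {v c : A → Sym} {w : A → List Sym} (hv : EmitsSym π v)
    (hc : EmitsSym π c) (hw : EmitsWord π w) : EmitsRule π fun a => answerRule (v a) (c a) (w a) :=
  emitsRule hv hc.nat hw

theorem emitsRule_erase {v : A → Sym} (hv : EmitsSym π v) : EmitsRule π fun a => eraseRule (v a) :=
  emitsRule hv (.const _) emitsWord_nil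

theorem emitsRule_challenge {v : A → Sym} {w : A → List Sym} (hv : EmitsSym π v)
    (hw : EmitsWord π w) : EmitsRule π fun a => challengeRule (v a) (w a) :=
  emitsRule_visible hv hv hw

theorem emitsRule_pop {v : A → Sym} (hv : EmitsSym π v) : EmitsRule π fun a => popRule (v a) :=
  emitsRule_visible hv (emitsSym_const bot) emitsWord_nil

theorem EmitsRules.flatMap_range {m : A → ℕ} {rs : A → ℕ → List SymRule}
    (hm : Emits π fun a => un (m a))
    (h : ∀ (A' : Type) (π' : A' → ℕ → List Γ') (k : A' → A) (j : A' → ℕ), Extends π' π k →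
      Emits π' (fun x => un (j x)) → Emits π' (fun x => un (m (k x) - 1 - j x)) →
      EmitsRules π' fun x => rs (k x) (j x)) :
    EmitsRules π fun a => (List.range (m a)).flatMap (rs a) := fun p =>
  (Emits.forRange hm (o := fun a j => (rs a j).flatMap fun r => r.write p)
    fun A' π' k j e h1 h2 => h A' π' k j e h1 h2 p).congr fun a => by rw [List.flatMap_assoc]

theorem EmitsRules.map_range {m : A → ℕ} {r : A → ℕ → SymRule} (hm : Emits π fun a => un (m a))
    (h : ∀ (A' : Type) (π' : A' → ℕ → List Γ') (k : A' → A) (j : A' → ℕ), Extends π' π k →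
      Emits π' (fun x => un (j x)) → EmitsRule π' fun x => r (k x) (j x)) :
    EmitsRules π fun a => (List.range (m a)).map (r a) := fun p =>
  (Emits.forRange hm (o := fun a j => (r a j).write p)
    fun A' π' k j e h1 _ => h A' π' k j e h1 p).congr fun a => by rw [List.flatMap_map]

end EmitsRules

/-! ### The rules of the counter -/

theorem emitsRules_bitRules {j : A → ℕ} (b : Bool) (hj : Emits π fun a => un (j a)) :
    EmitsRules π fun a => bitRules (j a) b :=
  have h := emitsSym_bit b hj
  (emitsRule_erase h).cons ((emitsRule_challenge h emitsWord_nil).cons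
    ((emitsRule_visible (emitsSym_const _) h
      ((emitsSym_const (weight 0)).cons (h.cons emitsWord_nil))).cons emitsRules_nil))

theorem emits_un_add {m n : A → ℕ} (hm : Emits π fun a => un (m a))
    (hn : Emits π fun a => un (n a)) : Emits π fun a => un (m a + n a) :=
  (hm.append hn).congr fun _ => (un_add _ _).symm

theorem emitsRules_lowRules {k j : A → ℕ} (b : Bool) (hk : Emits π fun a => un (k a))
    (hj : Emits π fun a => un (j a)) : EmitsRules π fun a => lowRules (k a) (j a) b :=
  have h := emitsSym_bit b hj
  have hw := emitsSym_weight_two_pow hk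
  (emitsRule_visible hw h (hw.cons (h.cons emitsWord_nil))).cons emitsRules_nil

theorem emitsRules_carryRules {k m : A → ℕ} (b : Bool) (hk : Emits π fun a => un (k a))
    (hm : Emits π fun a => un (m a)) : EmitsRules π fun a => carryRules (k a) (m a) b := by
  have hw := emitsSym_weight_two_pow hk
  have h := fun b => emitsSym_bit b (emits_un_add hk hm)
  refine (EmitsRules.map_range hm fun A' π' f j e hj => ?_).append
    ((emitsRule_visible hw (h b) (hw.cons ((h !b).cons (EmitsWord.map_range hm
      fun A' π' f j e hj => emitsSym_bit true (emits_un_add (hk.lift e) hj))))).cons emitsRules_nil)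
  exact emitsRule_visible (hw.lift e) ((h b).lift e) ((hw.lift e).cons (((h b).lift e).cons
    ((emitsSym_bit false (emits_un_add (hk.lift e) hj)).cons emitsWord_nil)))

theorem emitsRules_overflowRules {k m : A → ℕ} (hk : Emits π fun a => un (k a))
    (hm : Emits π fun a => un (m a)) : EmitsRules π fun a => overflowRules (k a) (m a) := by
  have hw := emitsSym_weight_two_pow hk
  refine EmitsRules.map_range hm fun A' π' f j e hj => ?_
  exact emitsRule_visible (hw.lift e) (emitsSym_const _) ((hw.lift e).cons
    ((emitsSym_const _).cons ((emitsSym_bit false (emits_un_add (hk.lift e) hj)).cons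
      emitsWord_nil)))

theorem emitsRules_counterRules {n : A → ℕ} (hn : Emits π fun a => un (n a)) :
    EmitsRules π fun a => counterRules (n a) := by
  have hc := fun v => emitsSym_const (π := π) v
  have hn' : Emits π fun a => un (n a + 1) := emits_un_add hn (.const (un 1))
  refine (EmitsRules.append ?_ (EmitsRules.flatMap_range hn ?_)).append
    (EmitsRules.flatMap_range hn' ?_)
  · exact (emitsRule_pop (hc _)).cons ((emitsRule_erase (hc _)).cons
      ((emitsRule_challenge (hc _) emitsWord_nil).cons
      ((emitsRule_visible (hc _) (hc _) ((hc _).cons emitsWord_nil)).cons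
      ((emitsRule_visible (hc _) (hc _) ((hc _).cons ((hc _).cons emitsWord_nil))).cons
        emitsRules_nil))))
  · intro A' π' f j e hj _
    have hj' : Emits π' fun a => un (j a + 1) := emits_un_add hj (.const (un 1))
    have hc := fun v => emitsSym_const (π := π') v
    refine (EmitsRules.append (EmitsRule.cons ?_ ?_) (EmitsRules.flatMap_range hj ?_)).append
      (EmitsRules.flatMap_range hj' ?_)
    · exact emitsRule_visible (hc _) (emitsSym_bit false hj) ((hc _).cons emitsWord_nil)
    · exact (emitsRules_bitRules false hj).append (emitsRules_bitRules true hj)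
    · intro A'' π'' f' i e' hi _
      exact (emitsRules_lowRules false (hj.lift e') hi).append
        (emitsRules_lowRules true (hj.lift e') hi)
    · intro A'' π'' f' i e' hi hr
      -- The loop has `j + 1` rounds, so `j - i` of them remain in round `i`; this is the distance
      -- that the carry rules need.
      have hr' : Emits π'' fun x => un (j (f' x) - i x) := hr.congr fun x => by
        rw [Nat.add_sub_cancel]
      exact (emitsRules_carryRules false hi hr').append (emitsRules_carryRules true hi hr')
  · intro A' π' f i e hi hr
    exact emitsRules_overflowRules hi (hr.congr fun x => by rw [Nat.add_sub_cancel])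

end HitOrRunGame

namespace HitOrRunGame

open HitOrRunGame.Sym StackProgram

variable {A : Type} {π : A → ℕ → List Γ'} {K : A → HitOrRunGame}

/-! ### The rules of the states -/

theorem emits_flatMap_stackSyms {o : A → Sym → List Γ'} (hn : Emits π fun a => un (K a).width)
    (h : ∀ (A' : Type) (π' : A' → ℕ → List Γ') (k : A' → A) (Y : A' → Sym), Extends π' π k →
      EmitsSym π' Y → Emits π' fun x => o (k x) (Y x)) :
    Emits π fun a => (K a).stackSyms.flatMap (o a) :=
  ((h A π id _ (.refl _) (emitsSym_const bot)).append
    ((h A π id _ (.refl _) (emitsSym_const (weight 0))).append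
      (Emits.forRange hn (o := fun a j => o a (weight (2 ^ j))) fun A' π' k j e hj _ =>
        h A' π' k _ e (emitsSym_weight_two_pow hj)))).congr fun a => by
    simp [stackSyms, List.flatMap_map]

theorem EmitsRules.flatMap_stackSyms {rs : A → Sym → List SymRule}
    (hn : Emits π fun a => un (K a).width)
    (h : ∀ (A' : Type) (π' : A' → ℕ → List Γ') (k : A' → A) (Y : A' → Sym), Extends π' π k →
      EmitsSym π' Y → EmitsRules π' fun x => rs (k x) (Y x)) :
    EmitsRules π fun a => (K a).stackSyms.flatMap (rs a) := fun p =>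
  (emits_flatMap_stackSyms hn (o := fun a Y => (rs a Y).flatMap fun r => r.write p)
    fun A' π' k Y e hY => h A' π' k Y e hY p).congr fun a => by rw [List.flatMap_assoc]

theorem EmitsRules.map_stackSyms {r : A → Sym → SymRule} (hn : Emits π fun a => un (K a).width)
    (h : ∀ (A' : Type) (π' : A' → ℕ → List Γ') (k : A' → A) (Y : A' → Sym), Extends π' π k →
      EmitsSym π' Y → EmitsRule π' fun x => r (k x) (Y x)) :
    EmitsRules π fun a => (K a).stackSyms.map (r a) := fun p =>
  (emits_flatMap_stackSyms hn (o := fun a Y => (r a Y).write p)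
    fun A' π' k Y e hY => h A' π' k Y e hY p).congr fun a => by rw [List.flatMap_map]

theorem emitsRules_stateRules {s : A → ℕ} {u : A → List Sym}
    (hn : Emits π fun a => un (K a).width) (hs : Emits π fun a => Enc.nat (s a))
    (hu : EmitsWord π u) : EmitsRules π fun a => (K a).stateRules (s a) (u a) := by
  have hw := emitsSym_win hs
  refine ((emitsRule_erase hw).cons ((emitsRule_challenge hw
    ((emitsSym_const guard).cons emitsWord_nil)).cons emitsRules_nil)).append
    (EmitsRules.map_stackSyms hn fun A' π' k Y e hY => ?_)
  exact emitsRule_visible hY (hw.lift e)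
    ((EmitsSym.cons (emitsSym_const guard) (hu.lift e)).append (hY.cons emitsWord_nil))

theorem emitsRules_transRules {r : A → ℕ × ℕ × ℕ} (hn : Emits π fun a => un (K a).width)
    (hs : Emits π fun a => Enc.nat (r a).1) (hl : Emits π fun a => Enc.nat (r a).2.1)
    (ht : Emits π fun a => Enc.nat (r a).2.2) :
    EmitsRules π fun a => (K a).transRules (r a) := by
  have hm := emitsSym_move hl ht
  have hw := emitsSym_weight hl
  have he := emitsSym_every hs
  have hgw := (emitsSym_const guard).cons (hw.cons emitsWord_nil)
  refine ((emitsRule_erase he).cons ((emitsRule_visible he hm hgw).cons ((emitsRule_erase hm).cons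
    ((emitsRule_challenge hm hgw).cons emitsRules_nil)))).append
    (EmitsRules.flatMap_stackSyms hn fun A' π' k Y e hY => ?_)
  have hY' := hY.cons emitsWord_nil
  exact (emitsRule_visible hY ((emitsSym_any hs).lift e)
      ((emitsSym_const guard).cons ((hm.lift e).cons hY'))).cons
    ((emitsRule_visible hY (hm.lift e) ((emitsSym_const guard).cons
      (((emitsSym_win ht).lift e).cons ((hw.lift e).cons hY')))).cons emitsRules_nil)

/-! ### The final tests -/

theorem encodePosNum_eq_map_testBit (p : PosNum) :
    encodePosNum p = (List.range (encodePosNum p).length).map (p : ℕ).testBit := by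
  induction p with
  | one => rfl
  | bit0 p ih =>
    rw [encodePosNum, List.length_cons, List.range_succ_eq_map, List.map_cons, List.map_map,
      PosNum.cast_bit0]
    congr 1
    · simp only [Nat.testBit_zero]; simp; omega
    · nth_rw 1 [ih]
      refine List.map_congr_left fun i _ => ?_
      simp only [Function.comp, Nat.testBit_succ]
      congr 1
      omega
  | bit1 p ih =>
    rw [encodePosNum, List.length_cons, List.range_succ_eq_map, List.map_cons, List.map_map,
      PosNum.cast_bit1]
    congr 1
    · simp only [Nat.testBit_zero]; simp; omega
    · nth_rw 1 [ih]
      refine List.map_congr_left fun i _ => ?_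
      simp only [Function.comp, Nat.testBit_succ]
      congr 1
      omega

theorem encodeNat_eq_map_testBit (n : ℕ) :
    encodeNat n = (List.range (encodeNat n).length).map n.testBit := by
  rw [encodeNat]
  cases h : (n : Num) with
  | zero => rfl
  | pos p =>
    have : n = (p : ℕ) := by rw [← Num.to_of_nat n, h]; rfl
    rw [this]
    exact encodePosNum_eq_map_testBit p

theorem flatMap_blank (w : List Γ') : (w.flatMap fun _ => [Γ'.blank]) = un w.length := by
  induction w with
  | nil => rfl
  | cons c w ih => rw [List.flatMap_cons, ih]; rfl

/-- A scan of the binary code from the least significant digit, in which the length of the part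
already read is the position of the current bit. -/
theorem emits_bits {v : A → ℕ} {o : A → ℕ → Bool → List Γ'}
    (hv : Emits π fun a => (encodeNat (v a)).map Γ'.bit)
    (h : ∀ (A' : Type) (π' : A' → ℕ → List Γ') (k : A' → A) (j : A' → ℕ) (b : Bool),
      Extends π' π k → Emits π' (fun x => un (j x)) → Emits π' fun x => o (k x) (j x) b) :
    Emits π fun a => (List.range (encodeNat (v a)).length).flatMap
      fun j => o a j ((v a).testBit j) := by
  refine hv.bind ((Emits.scan 0 (Q := Unit) (fun _ _ => ()) ()
    (o := fun a _ c p _ => o a p.length (c == Γ'.bit true)) (fun _ _ _ _ => True)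
    (fun _ => trivial) (fun _ _ _ _ _ _ => trivial) fun _ c => ?_).congr fun a => ?_)
  · refine h _ _ (fun x : {_x : A × List Γ' × List Γ' // True} => x.1.1)
      (fun x => x.1.2.1.length) _ ⟨fun i => i + 3, fun _ _ => rfl⟩ ?_
    exact ((Emits.reg 1 fun _ => rfl).flatMap fun _ => [Γ'.blank]).congr fun x => flatMap_blank _
  · have : ∀ (t : ℕ → Bool) (w : List Bool) (p : List Γ'),
        w = (List.range' p.length w.length).map t →
        scanOut (fun (_ : Unit) _ => ()) (fun _ c p _ => o a p.length (c == Γ'.bit true)) () p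
          (w.map Γ'.bit) = (List.range' p.length w.length).flatMap fun j => o a j (t j) := by
      intro t w
      induction w with
      | nil => exact fun _ _ => rfl
      | cons b w ih =>
        intro p hw
        rw [List.length_cons, List.range'_succ, List.map_cons, List.cons.injEq] at hw
        rw [List.map_cons, scanOut, ih (Γ'.bit b :: p) hw.2, List.length_cons (as := w),
          List.range'_succ, List.flatMap_cons, ← hw.1]
        congr 2
        cases b <;> rfl
    rw [List.range_eq_range']
    exact this _ _ [] ((encodeNat_eq_map_testBit _).trans (by rw [List.range_eq_range']; rfl))

/-- The range of positions is split at the length of the binary code of the final value: up to there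
the bits are read from the code, beyond it they are all zero. -/
theorem emitsWord_finalTests (hn : Emits π fun a => un (Enc.game (K a)).length)
    (hv : Emits π fun a => (encodeNat (K a).finalValue).map Γ'.bit)
    (hm : Emits π fun a => un (encodeNat (K a).finalValue).length) :
    EmitsWord π fun a => (K a).finalTests := by
  refine (emitsSym_const bounded).cons (Emits.congr ((emits_bits hv
    (o := fun _ j b => Enc.nat (bit j b).name) fun A' π' k j b e hj => (emitsSym_bit b hj).nat).append
    (Emits.forRange hn (o := fun a j => Enc.nat (bit ((encodeNat (K a).finalValue).length + j)
      false).name) fun A' π' k j e hj _ => (emitsSym_bit false (emits_un_add (hm.lift e) hj)).nat))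
    fun a => ?_)
  have h : ∀ j, (K a).finalValue.testBit ((encodeNat (K a).finalValue).length + j) = false :=
    fun j => Nat.testBit_lt_two_pow ((lt_two_pow_length_encodeNat _).trans_le
      (Nat.pow_le_pow_right (by norm_num) (Nat.le_add_right _ _)))
  simp only [width, List.range_add, List.map_append, List.flatMap_append, List.flatMap_map, h]

/-! ### The reduction -/

theorem ket_notMem_nat (n : ℕ) : Γ'.ket ∉ Enc.nat n := by simp [Enc.nat]

theorem ket_notMem_trans (r : ℕ × ℕ × ℕ) : Γ'.ket ∉ Enc.trans r := by
  simp [Enc.trans, ket_notMem_nat]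

theorem emits_toInstance :
    Emits (fun G : HitOrRunGame => single (Enc.game G)) fun G => Enc.bpa (G.toInstance Sym.name) := by
  set π := fun G : HitOrRunGame => single (Enc.game G)
  have hg : Emits π Enc.game := .reg 0 fun _ => rfl
  -- The code of the game is parsed from the left; each step provides one component and the
  -- remaining word.
  obtain ⟨h0, hg0⟩ := Emits.entries (e := Enc.nat) (l := S₀) (u := fun G => Enc.list Enc.nat G.S₁ ++
    (Enc.list Enc.trans G.trans ++ (Enc.nat G.start ++ (Enc.nat G.final ++
      (Enc.nat G.finalValue ++ []))))) ket_notMem_nat (hg.congr fun G => by simp [Enc.game])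
  obtain ⟨h1, hg1⟩ := Emits.entries ket_notMem_nat hg0
  obtain ⟨h2, hg2⟩ := Emits.entries ket_notMem_trans hg1
  have hs := hg2.firstToken
  have hg3 := hg2.dropToken
  have hf := hg3.firstToken
  have hg4 := hg3.dropToken
  have hv : Emits π fun G => (encodeNat G.finalValue).map Γ'.bit :=
    Emits.before Γ'.comma (u := fun _ => []) (fun G => by simp)
      (hg4.congr fun G => by simp [Enc.nat])
  have hun : ∀ {w : HitOrRunGame → List Γ'}, Emits π w → Emits π fun G => un (w G).length :=
    fun h => (h.flatMap fun _ => [Γ'.blank]).congr fun G => flatMap_blank _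
  have hm : Emits π fun G => un (encodeNat G.finalValue).length :=
    (hun hv).congr fun G => by rw [List.length_map]
  have hn : Emits π fun G => un G.width := emits_un_add hm (hun hg)
  have hpop : EmitsRules π fun G => G.stackSyms.map popRule :=
    EmitsRules.map_stackSyms (K := fun G => G) (r := fun _ => popRule) hn
      fun A' π' k Y e hY => emitsRule_pop hY
  have hfinal : EmitsRules π fun G => G.stateRules G.final G.finalTests :=
    emitsRules_stateRules (K := fun G => G) (s := fun G => G.final) (u := fun G => G.finalTests)
      hn hf (emitsWord_finalTests (K := fun G => G) (hun hg) hv hm)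
  have hr : EmitsRules π fun G => G.symRules := by
    refine ((((hpop.append (emitsRules_counterRules hn)).append fun p => ?_).append
      fun p => ?_).append hfinal).append fun p => ?_
    · refine (h0.forNats fun A' π' k s e hs => ?_).congr fun a => List.flatMap_assoc.symm
      have ha := emitsSym_any hs
      exact ((emitsRule_erase ha).cons ((emitsRule_challenge ha
        ((emitsSym_const guard).cons emitsWord_nil)).cons emitsRules_nil)).append
        (emitsRules_stateRules (hn.lift e) hs (ha.cons emitsWord_nil)) p
    · refine (h1.forNats fun A' π' k s e hs => ?_).congr fun a => List.flatMap_assoc.symm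
      exact emitsRules_stateRules (hn.lift e) hs ((emitsSym_every hs).cons emitsWord_nil) p
    · refine (h2.forTrans fun A' π' k s e hs hl ht => ?_).congr fun a => List.flatMap_assoc.symm
      exact emitsRules_transRules (hn.lift e) hs hl ht p
  have hlist : ∀ {w : HitOrRunGame → List Γ'}, Emits π w →
      Emits π fun G => Γ'.bra :: w G ++ [Γ'.ket] := fun h =>
    ((Emits.const [Γ'.bra]).append h).append (.const [Γ'.ket])
  have hbot : EmitsWord π fun _ => [bot] := (emitsSym_const bot).cons emitsWord_nil
  refine (((((hlist (hr .vars)).append (hlist (hr .acts))).append (hlist (hr .rules))).append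
    (hlist ((emitsSym_win hs).cons hbot))).append (hlist hbot)).congr fun G => ?_
  simp only [Enc.bpa, Enc.list, toInstance, toSystem, List.flatMap_map, List.flatMap_assoc,
    SymRule.write]

end HitOrRunGame

theorem mainTheorem2 :
    ∃ f : HitOrRunGame → BPA.Instance,
      Nonempty (TM2ComputableInPolyTime Enc.game Enc.bpa f) ∧
      ∀ G : HitOrRunGame,
        (f G).sys.Normed ∧
        (G.PlayerZeroWins ↔ (f G).sys.BranchingBisimilar (f G).left (f G).right) ∧
        ((f G).sys.BranchingBisimilar (f G).left (f G).right ↔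
          (f G).sys.WeaklyBisimilar (f G).left (f G).right) :=
  ⟨fun G => G.toInstance HitOrRunGame.Sym.name, StackProgram.Emits.computable HitOrRunGame.emits_toInstance,
    fun _ => HitOrRunGame.toInstance_correct HitOrRunGame.Sym.name_injective⟩
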